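/- **Theorem (soundness of strong open bisimilarity for the spi calculus).** Let $P$ and $Q$ be processes of the spi calculus. If $P \sim_o Q$ (strong open bisimilarity) then $P \sim Q$ (testing equivalence). The notions are as follows. *Syntax.* Fix two disjoint countably infinite sets: names $x,y,\dots$ and rigid names $\mathbf a,\mathbf c,\mathbf d,\dots$. Messages are $M,N ::= x \mid \mathbf a \mid \langle M,N\rangle \mid \{M\}_N$. Processes, modulo renaming of bound names, are $$P ::= 0 \mid \bar M\langle N\rangle.P \mid M(x).P \mid P|P \mid (\nu x)P \mid\ !P \mid [M=N]P \mid \mathrm{let}\ \langle x,y\rangle = L\ \mathrm{in}\ P \mid \mathrm{case}\ L\ \mathrm{of}\ \{x\}_N\ \mathrm{in}\ P .$$ $fn$ and $rn$ denote the sets of free names and of rigid names; messages and processes with $rn=\emptyset$ are *pure*. Substitutions map names to messages, have finite domain, and act without capture. *Transitions.* Agents are processes, abstractions $(x)P$ and concretions $(\nu\vec y)\langle M\rangle P$. With bound names chosen fresh: $(\nu x)(z)P = (z)(\nu x)P$; $(\nu x)(\nu\vec y)\langle M\rangle P$ is $(\nu x,\vec y)\langle M\rangle P$ if $x\in fn(M)$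 and $(\nu\vec y)\langle M\rangle(\nu x)P$ otherwise; $R|(x)P=(x)(R|P)$, $R|(\nu\vec y)\langle M\rangle P=(\nu\vec y)\langle M\rangle(R|P)$, and symmetrically on the right. For $F=(x)P$ and $C=(\nu\vec y)\langle M\rangle Q$ put $F@C=(\nu\vec y)(P[M/x]\,|\,Q)$ and $C@F=(\nu\vec y)(Q\,|\,P[M/x])$. Reduction: $!P>P|!P$; $[M=M]P>P$; $\mathrm{let}\ \langle x,y\rangle=\langle M,N\rangle\ \mathrm{in}\ P>P[M/x][N/y]$; $\mathrm{case}\ \{M\}_N\ \mathrm{of}\ \{x\}_N\ \mathrm{in}\ P>P[M/x]$. Actions are $\tau$, $M$ (input) and $\bar M$ (output). Transitions are generated by: $M(x).P\xrightarrow{M}(x)P$; $\bar M\langle N\rangle.P\xrightarrow{\bar M}\langle N\rangle P$; if $P\xrightarrow{M}F$ and $Q\xrightarrow{\bar M}C$ then $P|Q\xrightarrow{\tau}F@C$ and $Q|P\xrightarrow{\tau}C@F$; if $P>Q$ and $Q\xrightarrow{\alpha}A$ then $P\xrightarrow{\alpha}A$; if $P\xrightarrow{\alpha}A$ then $P|Q\xrightarrow{\alpha}A|Q$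 and $Q|P\xrightarrow{\alpha}Q|A$; if $P\xrightarrow{\alpha}A$ and $m\notin fn(\alpha)$ then $(\nu m)P\xrightarrow{\alpha}(\nu m)A$. *Testing equivalence.* A *barb* $\beta$ is an input or output action $M$ or $\bar M$ with $M$ pure. Pure processes $P,Q$ satisfy $P\sim Q$ if for every pure process $R$ and every barb $\beta$: $P|R\xrightarrow{\tau}{}^{*}P'\xrightarrow{\beta}A$ for some $P',A$ if and only if $Q|R\xrightarrow{\tau}{}^{*}Q'\xrightarrow{\beta}B$ for some $Q',B$. *Observer theories.* A theory $\Gamma$ is a finite set of pairs of messages, with projections $\pi_1(\Gamma),\pi_2(\Gamma)$. $\Gamma\vdash M\leftrightarrow N$ is the least relation such that: $\Gamma\vdash x\leftrightarrow x$ for each name $x$; $\Gamma\vdash M\leftrightarrow N$ if $(M,N)\in\Gamma$; if $\Gamma\vdash M\leftrightarrow M'$ and $\Gamma\vdash N\leftrightarrow N'$ then $\Gamma\vdash\langle M,N\rangle\leftrightarrow\langle M',N'\rangle$ and $\Gamma\vdash\{M\}_N\leftrightarrow\{M'\}_{N'}$; if $(\langle M_1,N_1\rangle,\langle M_2,N_2\rangle)\in\Gamma$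 and $\Gamma,(M_1,M_2),(N_1,N_2)\vdash M\leftrightarrow N$ then $\Gamma\vdash M\leftrightarrow N$; if $(\{M_1\}_{N_1},\{M_2\}_{N_2})\in\Gamma$, $\Gamma\vdash N_1\leftrightarrow N_2$ and $\Gamma,(M_1,M_2),(N_1,N_2)\vdash M\leftrightarrow N$ then $\Gamma\vdash M\leftrightarrow N$. For a set $\Sigma$ of messages, $\Sigma\vdash M$ is defined by the same rules with single messages in place of pairs. $\Gamma$ is *consistent* if $\Gamma\vdash M\leftrightarrow N$ implies: (1) $M,N$ are of the same type (both names, both rigid names, both pairs or both encryptions); (2) if $M=\{M_1\}_{M_2}$ and $N=\{N_1\}_{N_2}$ then $\pi_1(\Gamma)\vdash M_2$ implies $\Gamma\vdash M_2\leftrightarrow N_2$, and $\pi_2(\Gamma)\vdash N_2$ implies $\Gamma\vdash M_2\leftrightarrow N_2$; (3) for all $R$, $\Gamma\vdash M\leftrightarrow R$ implies $R=N$ and $\Gamma\vdash R\leftrightarrow N$ implies $R=M$. *Bi-traces.* A bi-trace $h$ is a finite list of pairs $(M,N)^i$ or $(M,N)^o$ such that $h=h_1.(M,N)^o.h_2$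 implies $fn(M,N)\subseteq fn(h_1)$. $\{h\}$ is its underlying theory, and $h\vdash M\leftrightarrow N$ means $\{h\}\vdash M\leftrightarrow N$; $\pi_1(h)$ is $\pi_1(\{h\})$ as a set; $h^{-1}$ exchanges the components of each pair; a substitution pair $\vec\theta=(\theta_1,\theta_2)$ acts componentwise. $\vec\theta$ *respects* $h$ if $h=h_1.(M,N)^i.h_2$ implies $h_1\vec\theta\vdash x\theta_1\leftrightarrow x\theta_2$ for all $x\in fn(M,N)$. *Consistency* of bi-traces is defined by induction on length: $[\,]$ is consistent; $h.(M,N)^i$ is consistent if $h$ is and $h\vdash M\leftrightarrow N$; $h'=h.(M,N)^o$ is consistent if $h$ is and, for every $\vec\theta$ respecting $h$ such that $h\vec\theta$ is a consistent bi-trace, $\{h'\vec\theta\}$ is a consistent theory. A *universal bi-trace* is one of the form $(x_1,x_1)^i.\cdots.(x_n,x_n)^i$ with $n\ge 0$ and the $x_j$ names. *Open bisimilarity.* A set $\mathcal R$ of triples $(h,P,Q)$, with $h$ a bi-trace and $fn(P,Q)\subseteq fn(h)$, is a *strong open bisimulation* if every $h$ occurring in it is consistent, $(h,P,Q)\in\mathcal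 R$ iff $(h^{-1},Q,P)\in\mathcal R$, and for all $(h,P,Q)\in\mathcal R$ and all $\vec\theta$ respecting $h$: 1. if $P\theta_1\xrightarrow{\tau}P'$ then $Q\theta_2\xrightarrow{\tau}Q'$ for some $Q'$ with $(h\vec\theta,P',Q')\in\mathcal R$; 2. if $P\theta_1\xrightarrow{M}(x)P'$ with $x\notin fn(h\vec\theta)$ and $\pi_1(h\vec\theta)\vdash M$, then $Q\theta_2\xrightarrow{N}(x)Q'$ for some $N,Q'$ with $(h\vec\theta.(M,N)^i.(x,x)^i,P',Q')\in\mathcal R$; 3. if $P\theta_1\xrightarrow{\bar M}(\nu\vec x)\langle M'\rangle P'$ and $\pi_1(h\vec\theta)\vdash M$, then $Q\theta_2\xrightarrow{\bar N}(\nu\vec y)\langle N'\rangle Q'$ for some $N,N',\vec y,Q'$, and there are vectors $\vec{\mathbf c}$, $\vec{\mathbf d}$ of rigid names, each without repetitions, with $\{\vec{\mathbf c},\vec{\mathbf d}\}\cap rn(h\vec\theta,P\theta_1,Q\theta_2)=\emptyset$ and $$(h\vec\theta.(M,N)^i.(M'[\vec{\mathbf c}/\vec x],N'[\vec{\mathbf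 d}/\vec y])^o,\ P'[\vec{\mathbf c}/\vec x],\ Q'[\vec{\mathbf d}/\vec y])\in\mathcal R .$$ $P\sim_o Q$ means that $P$ and $Q$ are pure and $(h,P,Q)$ belongs to some strong open bisimulation for some universal bi-trace $h$. -/

import Mathlib

namespace Spi

/-! ## Messages and processes

Names are the elements of `ℕ` and rigid names are the elements of a second copy of `ℕ`.
Processes are taken modulo renaming of bound names: they are represented in de Bruijn style.
A binder binds the index `0` of its body, and the free name `x` is written `x + d`
when it occurs under `d` binders. Every term below therefore denotes a process modulo
alpha-equivalence, and two alpha-equivalent processes are equal terms. -/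

/-- Messages: names, rigid names, pairs, and `enc M N` (the message `M` encrypted with key `N`). -/
inductive Msg : Type
  | name (x : ℕ) : Msg
  | rigid (a : ℕ) : Msg
  | pair (M N : Msg) : Msg
  | enc (M N : Msg) : Msg

namespace Msg

/-- Application of a substitution to a message. -/
def subst (σ : ℕ → Msg) : Msg → Msg
  | name x => σ x
  | rigid a => rigid a
  | pair M N => pair (M.subst σ) (N.subst σ)
  | enc M N => enc (M.subst σ) (N.subst σ)

/-- Renaming of the names of a message. -/
def rename (f : ℕ → ℕ) (M : Msg) : Msg := M.subst (fun x => name (f x))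

/-- Free names of a message. -/
def fn : Msg → Set ℕ
  | name x => {x}
  | rigid _ => ∅
  | pair M N => M.fn ∪ N.fn
  | enc M N => M.fn ∪ N.fn

/-- Rigid names of a message. -/
def rn : Msg → Set ℕ
  | name _ => ∅
  | rigid a => {a}
  | pair M N => M.rn ∪ N.rn
  | enc M N => M.rn ∪ N.rn

/-- A message is pure if it contains no rigid names. -/
def Pure (M : Msg) : Prop := M.rn = ∅

end Msg

/-- The substitution `σ` pushed under one binder. -/
def up (σ : ℕ → Msg) : ℕ → Msg
  | 0 => Msg.name 0
  | x + 1 => (σ x).rename (· + 1)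

/-- Processes of the spi calculus. -/
inductive Proc : Type
  /-- the process `0` -/
  | nil : Proc
  /-- output of `N` on channel `M`, then `P` -/
  | out (M N : Msg) (P : Proc) : Proc
  /-- input `M(x).P`; binds one name in `P` -/
  | inp (M : Msg) (P : Proc) : Proc
  /-- parallel composition `P | Q` -/
  | par (P Q : Proc) : Proc
  /-- restriction `(ν x) P`; binds one name in `P` -/
  | res (P : Proc) : Proc
  /-- replication `!P` -/
  | rep (P : Proc) : Proc
  /-- matching `[M = N] P` -/
  | mat (M N : Msg) (P : Proc) : Proc
  /-- `let (x, y) = L in P`; binds two names in `P`, `x` being the index `1` and `y` the index `0` -/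
  | letp (L : Msg) (P : Proc) : Proc
  /-- `case L of {x}_N in P`; binds one name in `P` -/
  | dec (L N : Msg) (P : Proc) : Proc

namespace Proc

/-- Application of a substitution to a process (capture avoiding, as bound names are indices). -/
def subst : (ℕ → Msg) → Proc → Proc
  | _, nil => nil
  | σ, out M N P => out (M.subst σ) (N.subst σ) (P.subst σ)
  | σ, inp M P => inp (M.subst σ) (P.subst (up σ))
  | σ, par P Q => par (P.subst σ) (Q.subst σ)
  | σ, res P => res (P.subst (up σ))
  | σ, rep P => rep (P.subst σ)
  | σ, mat M N P => mat (M.subst σ) (N.subst σ) (P.subst σ)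
  | σ, letp L P => letp (L.subst σ) (P.subst (up (up σ)))
  | σ, dec L N P => dec (L.subst σ) (N.subst σ) (P.subst (up σ))

/-- Renaming of the free names of a process. -/
def rename (f : ℕ → ℕ) (P : Proc) : Proc := P.subst (fun x => Msg.name (f x))

/-- Free names of a process. -/
def fn : Proc → Set ℕ
  | nil => ∅
  | out M N P => M.fn ∪ N.fn ∪ P.fn
  | inp M P => M.fn ∪ {x | x + 1 ∈ P.fn}
  | par P Q => P.fn ∪ Q.fn
  | res P => {x | x + 1 ∈ P.fn}
  | rep P => P.fn
  | mat M N P => M.fn ∪ N.fn ∪ P.fn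
  | letp L P => L.fn ∪ {x | x + 2 ∈ P.fn}
  | dec L N P => L.fn ∪ N.fn ∪ {x | x + 1 ∈ P.fn}

/-- Rigid names of a process. -/
def rn : Proc → Set ℕ
  | nil => ∅
  | out M N P => M.rn ∪ N.rn ∪ P.rn
  | inp M P => M.rn ∪ P.rn
  | par P Q => P.rn ∪ Q.rn
  | res P => P.rn
  | rep P => P.rn
  | mat M N P => M.rn ∪ N.rn ∪ P.rn
  | letp L P => L.rn ∪ P.rn
  | dec L N P => L.rn ∪ N.rn ∪ P.rn

/-- A process is pure if it contains no rigid names. -/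
def Pure (P : Proc) : Prop := P.rn = ∅

/-- `(ν y₁, …, y_k) P`. -/
def resN : ℕ → Proc → Proc
  | 0, P => P
  | k + 1, P => res (resN k P)

end Proc

/-- Instantiation of the innermost bound name by `M`. -/
def inst (M : Msg) : ℕ → Msg
  | 0 => M
  | x + 1 => Msg.name x

/-- Instantiation of the two innermost bound names, `1` by `M` and `0` by `N`. -/
def inst2 (M N : Msg) : ℕ → Msg
  | 0 => N
  | 1 => M
  | x + 2 => Msg.name x

/-- Instantiation of the innermost bound name by a message `M` that lives under `k` binders. -/
def instUnder (k : ℕ) (M : Msg) : ℕ → Msg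
  | 0 => M
  | x + 1 => Msg.name (x + k)

/-- Instantiation of the `k` innermost bound names by the rigid names `c`. -/
def instRigid {k : ℕ} (c : Fin k → ℕ) (x : ℕ) : Msg :=
  if hx : x < k then Msg.rigid (c ⟨x, hx⟩) else Msg.name (x - k)

/-! ## Operational semantics -/

/-- Agents: processes, abstractions `(x) P` (binding one name), and concretions
`(ν y₁, …, y_k) ⟨M⟩ P` (binding `k` names, the indices `0, …, k - 1`, in both `M` and `P`). -/
inductive Agent : Type
  | proc (P : Proc) : Agent
  | abs (P : Proc) : Agent
  | conc (k : ℕ) (M : Msg) (P : Proc) : Agent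

namespace Agent

/-- `A | R`. -/
def parRight (R : Proc) : Agent → Agent
  | proc P => proc (P.par R)
  | abs P => abs (P.par (R.rename (· + 1)))
  | conc k M P => conc k M (P.par (R.rename (· + k)))

/-- `R | A`. -/
def parLeft (R : Proc) : Agent → Agent
  | proc P => proc (R.par P)
  | abs P => abs ((R.rename (· + 1)).par P)
  | conc k M P => conc k M ((R.rename (· + k)).par P)

open Classical in
/-- `(ν x) A`, where `x` is the free name `0` of `A`. Under the `k` binders of a concretion
this name is the index `k`; the restriction joins the binders of the concretion if `x` occurs in
the message, and is moved to the process otherwise. -/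
noncomputable def res : Agent → Agent
  | proc P => proc P.res
  | abs P => abs (P.rename (fun i => if i = 0 then 1 else if i = 1 then 0 else i)).res
  | conc k M P =>
      if k ∈ M.fn then conc (k + 1) M P
      else conc k (M.rename (fun i => if i < k then i else i - 1))
        (P.rename (fun i => if i < k then i + 1 else if i = k then 0 else i)).res

end Agent

/-- Actions: the silent action, input on a channel, output on a channel. -/
inductive Action : Type
  | tau : Action
  | inp (M : Msg) : Action
  | out (M : Msg) : Action

/-- The action `α` seen from under one more binder. -/
def Action.shift : Action → Action
  | tau => tau
  | inp M => inp (M.rename (· + 1))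
  | out M => out (M.rename (· + 1))

/-- The interaction `F @ C` of the abstraction `F = (x) P` and the concretion
`C = (ν y₁, …, y_k) ⟨M⟩ Q`, namely `(ν y₁, …, y_k) (P[M/x] | Q)`. -/
def interactFC (P : Proc) (k : ℕ) (M : Msg) (Q : Proc) : Proc :=
  Proc.resN k ((P.subst (instUnder k M)).par Q)

/-- The interaction `C @ F`, namely `(ν y₁, …, y_k) (Q | P[M/x])`. -/
def interactCF (k : ℕ) (M : Msg) (Q : Proc) (P : Proc) : Proc :=
  Proc.resN k (Q.par (P.subst (instUnder k M)))

/-- The reduction relation `P > Q`. -/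
inductive Red : Proc → Proc → Prop
  | rep (P : Proc) : Red P.rep (P.par P.rep)
  | mat (M : Msg) (P : Proc) : Red (Proc.mat M M P) P
  | letp (M N : Msg) (P : Proc) : Red (Proc.letp (Msg.pair M N) P) (P.subst (inst2 M N))
  | dec (M N : Msg) (P : Proc) : Red (Proc.dec (Msg.enc M N) N P) (P.subst (inst M))

/-- The one-step transition relation. In `res` the restricted name is the index `0` of `P`, so
that it does not occur in the action of `P` exactly when this action is of the form `α.shift`. -/
inductive Step : Proc → Action → Agent → Prop
  | inp (M : Msg) (P : Proc) : Step (Proc.inp M P) (Action.inp M) (Agent.abs P)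
  | out (M N : Msg) (P : Proc) : Step (Proc.out M N P) (Action.out M) (Agent.conc 0 N P)
  | commFC {P Q P' Q' : Proc} {M N : Msg} {k : ℕ} :
      Step P (Action.inp M) (Agent.abs P') → Step Q (Action.out M) (Agent.conc k N Q') →
      Step (P.par Q) Action.tau (Agent.proc (interactFC P' k N Q'))
  | commCF {P Q P' Q' : Proc} {M N : Msg} {k : ℕ} :
      Step P (Action.out M) (Agent.conc k N P') → Step Q (Action.inp M) (Agent.abs Q') →
      Step (P.par Q) Action.tau (Agent.proc (interactCF k N P' Q'))
  | red {P Q : Proc} {α : Action} {A : Agent} : Red P Q → Step Q α A → Step P α A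
  | parL {P Q : Proc} {α : Action} {A : Agent} : Step P α A → Step (P.par Q) α (A.parRight Q)
  | parR {P Q : Proc} {α : Action} {A : Agent} : Step Q α A → Step (P.par Q) α (A.parLeft P)
  | res {P : Proc} {α : Action} {A : Agent} : Step P α.shift A → Step P.res α A.res

/-! ## Testing equivalence -/

/-- A barb is an input or an output channel that contains no rigid names. -/
def IsBarb (β : Action) : Prop :=
  ∃ M : Msg, M.Pure ∧ (β = Action.inp M ∨ β = Action.out M)

/-- The silent transition between processes. -/
def TauStep (P P' : Proc) : Prop := Step P Action.tau (Agent.proc P')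

/-- `P` performs finitely many silent transitions and then the action `β`. -/
def Exhibits (P : Proc) (β : Action) : Prop :=
  ∃ (P' : Proc) (A : Agent), Relation.ReflTransGen TauStep P P' ∧ Step P' β A

/-- Testing equivalence of pure processes. -/
def TestingEquiv (P Q : Proc) : Prop :=
  P.Pure ∧ Q.Pure ∧ ∀ R : Proc, R.Pure → ∀ β : Action, IsBarb β →
    (Exhibits (P.par R) β ↔ Exhibits (Q.par R) β)

/-! ## Observer theories -/

/-- A theory is a set of pairs of messages (below, only the finite sets underlying bi-traces
are used as observer theories). -/
abbrev Theory : Type := Set (Msg × Msg)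

/-- First projection of a theory. -/
def Theory.pi1 (Γ : Theory) : Set Msg := {M | ∃ N, (M, N) ∈ Γ}

/-- Second projection of a theory. -/
def Theory.pi2 (Γ : Theory) : Set Msg := {N | ∃ M, (M, N) ∈ Γ}

/-- `Entails Γ M N`: the messages `M` and `N` are indistinguishable in the theory `Γ`. -/
inductive Entails : Theory → Msg → Msg → Prop
  | var {Γ : Theory} (x : ℕ) : Entails Γ (Msg.name x) (Msg.name x)
  | id {Γ : Theory} {M N : Msg} : (M, N) ∈ Γ → Entails Γ M N
  | pr {Γ : Theory} {M N M' N' : Msg} : Entails Γ M M' → Entails Γ N N' →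
      Entails Γ (Msg.pair M N) (Msg.pair M' N')
  | er {Γ : Theory} {M N M' N' : Msg} : Entails Γ M M' → Entails Γ N N' →
      Entails Γ (Msg.enc M N) (Msg.enc M' N')
  | pl {Γ : Theory} {M₁ N₁ M₂ N₂ M N : Msg} :
      (Msg.pair M₁ N₁, Msg.pair M₂ N₂) ∈ Γ →
      Entails (insert (M₁, M₂) (insert (N₁, N₂) Γ)) M N → Entails Γ M N
  | el {Γ : Theory} {M₁ N₁ M₂ N₂ M N : Msg} :
      (Msg.enc M₁ N₁, Msg.enc M₂ N₂) ∈ Γ → Entails Γ N₁ N₂ →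
      Entails (insert (M₁, M₂) (insert (N₁, N₂) Γ)) M N → Entails Γ M N

/-- `Synth S M`: the message `M` can be synthesized from the set of messages `S`. -/
inductive Synth : Set Msg → Msg → Prop
  | var {S : Set Msg} (x : ℕ) : Synth S (Msg.name x)
  | id {S : Set Msg} {M : Msg} : M ∈ S → Synth S M
  | pr {S : Set Msg} {M N : Msg} : Synth S M → Synth S N → Synth S (Msg.pair M N)
  | er {S : Set Msg} {M N : Msg} : Synth S M → Synth S N → Synth S (Msg.enc M N)
  | pl {S : Set Msg} {M N R : Msg} : Msg.pair M N ∈ S →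
      Synth (insert M (insert N S)) R → Synth S R
  | el {S : Set Msg} {M N R : Msg} : Msg.enc M N ∈ S → Synth S N →
      Synth (insert M (insert N S)) R → Synth S R

/-- Two messages are of the same type of expressions. -/
def SameType : Msg → Msg → Prop
  | Msg.name _, Msg.name _ => True
  | Msg.rigid _, Msg.rigid _ => True
  | Msg.pair _ _, Msg.pair _ _ => True
  | Msg.enc _ _, Msg.enc _ _ => True
  | _, _ => False

/-- Consistency of a theory. -/
def Theory.Consistent (Γ : Theory) : Prop :=
  ∀ M N : Msg, Entails Γ M N →
    SameType M N ∧
    (∀ M₁ M₂ N₁ N₂ : Msg, M = Msg.enc M₁ M₂ → N = Msg.enc N₁ N₂ →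
      (Synth Γ.pi1 M₂ → Entails Γ M₂ N₂) ∧ (Synth Γ.pi2 N₂ → Entails Γ M₂ N₂)) ∧
    (∀ R : Msg, (Entails Γ M R → R = N) ∧ (Entails Γ R N → R = M))

/-! ## Bi-traces -/

/-- Marks of message pairs: input and output. -/
inductive Mark : Type
  | i : Mark
  | o : Mark

/-- A pair of messages marked as input or output. -/
structure IOPair : Type where
  mark : Mark
  fst : Msg
  snd : Msg

/-- Lists of marked pairs. The list is stored with its last element first: the list `h`
extended at its end by the pair `p` is `p :: h`, and `h₁.p.h₂` is `h₂ ++ p :: h₁`. -/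
abbrev Trace : Type := List IOPair

namespace Trace

/-- The theory `{h}` underlying `h`. -/
def theory (h : Trace) : Theory := {p | ∃ e ∈ h, p = (e.fst, e.snd)}

/-- Free names of `h`. -/
def fn (h : Trace) : Set ℕ := {x | ∃ e ∈ h, x ∈ e.fst.fn ∪ e.snd.fn}

/-- Rigid names of `h`. -/
def rn (h : Trace) : Set ℕ := {a | ∃ e ∈ h, a ∈ e.fst.rn ∪ e.snd.rn}

/-- The inverse of `h`: the components of each pair are exchanged. -/
def inv (h : Trace) : Trace := h.map (fun e => ⟨e.mark, e.snd, e.fst⟩)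

/-- Application of the substitution pair `(θ₁, θ₂)` to `h`. -/
def subst (θ₁ θ₂ : ℕ → Msg) (h : Trace) : Trace :=
  h.map (fun e => ⟨e.mark, e.fst.subst θ₁, e.snd.subst θ₂⟩)

theorem length_subst (θ₁ θ₂ : ℕ → Msg) (h : Trace) :
    (subst θ₁ θ₂ h).length = h.length := by
  simp [subst]

/-- `h` is a bi-trace: the free names of an output pair occur earlier in `h`. -/
def IsBiTrace (h : Trace) : Prop :=
  ∀ (h₁ h₂ : Trace) (M N : Msg), h = h₂ ++ (⟨Mark.o, M, N⟩ : IOPair) :: h₁ →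
    M.fn ∪ N.fn ⊆ fn h₁

end Trace

/-- The substitution `θ` has a finite domain. -/
def FiniteDom (θ : ℕ → Msg) : Prop := {x | θ x ≠ Msg.name x}.Finite

/-- The substitution pair `(θ₁, θ₂)` respects `h`. -/
def Respects (θ₁ θ₂ : ℕ → Msg) (h : Trace) : Prop :=
  ∀ (h₁ h₂ : Trace) (M N : Msg), h = h₂ ++ (⟨Mark.i, M, N⟩ : IOPair) :: h₁ →
    ∀ x ∈ M.fn ∪ N.fn, Entails (h₁.subst θ₁ θ₂).theory (θ₁ x) (θ₂ x)

/-- `h` is a consistent bi-trace. -/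
def Trace.Consistent : Trace → Prop
  | [] => True
  | ⟨Mark.i, M, N⟩ :: h => Trace.Consistent h ∧ Entails (Trace.theory h) M N
  | ⟨Mark.o, M, N⟩ :: h =>
      Trace.Consistent h ∧ M.fn ∪ N.fn ⊆ Trace.fn h ∧
      ∀ θ₁ θ₂ : ℕ → Msg, FiniteDom θ₁ → FiniteDom θ₂ → Respects θ₁ θ₂ h →
        Trace.Consistent (Trace.subst θ₁ θ₂ h) →
        (Trace.theory (Trace.subst θ₁ θ₂ (⟨Mark.o, M, N⟩ :: h))).Consistent
termination_by h => h.length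
decreasing_by
  all_goals simp [Trace.length_subst]

/-- A universal bi-trace consists only of input pairs `(x, x)` where `x` is a name. -/
def Trace.Universal (h : Trace) : Prop :=
  ∀ e ∈ h, ∃ x : ℕ, e = ⟨Mark.i, Msg.name x, Msg.name x⟩

/-! ## Open bisimulation -/

/-- `(h, P, Q)` is a traced process pair. -/
def IsTracedPair (h : Trace) (P Q : Proc) : Prop :=
  h.IsBiTrace ∧ P.fn ∪ Q.fn ⊆ h.fn

/-- The set `𝓡` of traced process pairs is a strong open bisimulation. -/
structure IsOpenBisimulation (𝓡 : Trace → Proc → Proc → Prop) : Prop where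
  traced : ∀ h P Q, 𝓡 h P Q → IsTracedPair h P Q
  consistent : ∀ h P Q, 𝓡 h P Q → h.Consistent
  symmetric : ∀ h P Q, 𝓡 h P Q ↔ 𝓡 h.inv Q P
  tau : ∀ h P Q, 𝓡 h P Q → ∀ θ₁ θ₂ : ℕ → Msg, FiniteDom θ₁ → FiniteDom θ₂ →
    Respects θ₁ θ₂ h →
    ∀ P', Step (P.subst θ₁) Action.tau (Agent.proc P') →
      ∃ Q', Step (Q.subst θ₂) Action.tau (Agent.proc Q') ∧ 𝓡 (h.subst θ₁ θ₂) P' Q'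
  input : ∀ h P Q, 𝓡 h P Q → ∀ θ₁ θ₂ : ℕ → Msg, FiniteDom θ₁ → FiniteDom θ₂ →
    Respects θ₁ θ₂ h →
    ∀ M P' x, Step (P.subst θ₁) (Action.inp M) (Agent.abs P') →
      x ∉ (h.subst θ₁ θ₂).fn → Synth (h.subst θ₁ θ₂).theory.pi1 M →
      ∃ N Q', Step (Q.subst θ₂) (Action.inp N) (Agent.abs Q') ∧
        𝓡 (⟨Mark.i, Msg.name x, Msg.name x⟩ :: ⟨Mark.i, M, N⟩ :: h.subst θ₁ θ₂)
          (P'.subst (inst (Msg.name x))) (Q'.subst (inst (Msg.name x)))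
  output : ∀ h P Q, 𝓡 h P Q → ∀ θ₁ θ₂ : ℕ → Msg, FiniteDom θ₁ → FiniteDom θ₂ →
    Respects θ₁ θ₂ h →
    ∀ M k M' P', Step (P.subst θ₁) (Action.out M) (Agent.conc k M' P') →
      Synth (h.subst θ₁ θ₂).theory.pi1 M →
      ∃ N l N' Q', Step (Q.subst θ₂) (Action.out N) (Agent.conc l N' Q') ∧
        ∃ (c : Fin k → ℕ) (d : Fin l → ℕ), Function.Injective c ∧ Function.Injective d ∧
          (Set.range c ∪ Set.range d) ∩
            ((h.subst θ₁ θ₂).rn ∪ (P.subst θ₁).rn ∪ (Q.subst θ₂).rn) = ∅ ∧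
          𝓡 (⟨Mark.o, M'.subst (instRigid c), N'.subst (instRigid d)⟩ ::
              ⟨Mark.i, M, N⟩ :: h.subst θ₁ θ₂)
            (P'.subst (instRigid c)) (Q'.subst (instRigid d))

/-- Strong open `h`-bisimilarity: the union of all strong open bisimulations. -/
def OpenBisimilarAt (h : Trace) (P Q : Proc) : Prop :=
  ∃ 𝓡 : Trace → Proc → Proc → Prop, IsOpenBisimulation 𝓡 ∧ 𝓡 h P Q

/-- Strong open bisimilarity of pure processes. -/
def OpenBisimilar (P Q : Proc) : Prop :=
  P.Pure ∧ Q.Pure ∧ ∃ h : Trace, h.Universal ∧ OpenBisimilarAt h P Q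

end Spi

/-! A tester interacting with `P` and with `Q` never gets ahead of the bisimulation: the runs of `P
| R` and `Q | R` are followed in lockstep along the invariant `Config`. Up to private restrictions,
the two sides are `Pθ₁ | R₁` and `Qθ₂ | R₂`, where `(h, P, Q)` is in the bisimulation, `θ` respects
`h`, and `R₁`, `R₂` have the same shape with corresponding messages entailed by the theory of `hθ`
(`Proc.Rel`).

Rigid names in a trace stand for secrets that the processes have extruded; in a real run they are
restricted names. `Config` therefore sends names and rigid names injectively to names and restricts
`k` of them on one side and `l` on the other, since the two sides may extrude different numbers of
names.

Related observers simulate each other as long as the theory is consistent (`Proc.Rel.step`): equal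
types make destructors succeed together, uniqueness makes equality tests and channels agree, and the
key clause handles decryption. The theory stays consistent because consistency of bi-traces is
stable under respectful substitutions (`Trace.Consistent.subst`) and implies consistency of the
underlying theory (`Trace.Consistent.theory_consistent`).

A silent step of the whole has four sources (`config_tau`). A step of the process alone is matched
by the bisimulation, and one of the observer alone by `Proc.Rel.step`. If the process inputs, the
bisimulation records a fresh name for the received message, and `θ` afterwards replaces it by the
messages of the two observers. If the process outputs, its extruded names become fresh rigid names
and the two messages enter the theory, so the continuations of the observers remain related.

A pure channel is entailed with itself, so uniqueness forces the other side to answer with the same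
barb (`barb_of_rel`). The converse implication follows by symmetry, as a universal trace is its own
inverse. -/

namespace Spi

/-! ## Substitutions acting on names and rigid names -/

/-- A substitution that acts on names and on rigid names. -/
structure Sub : Type where
  nm : ℕ → Msg
  rg : ℕ → Msg

namespace Msg

/-- Application of a substitution of names and rigid names to a message. -/
def app (s : Sub) : Msg → Msg
  | name x => s.nm x
  | rigid a => s.rg a
  | pair M N => pair (M.app s) (N.app s)
  | enc M N => enc (M.app s) (N.app s)

end Msg

namespace Sub

/-- The substitution of names `σ`, which fixes the rigid names. -/
def ofNames (σ : ℕ → Msg) : Sub := ⟨σ, Msg.rigid⟩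

/-- The substitution `s` pushed under `k` binders. -/
def lift (k : ℕ) (s : Sub) : Sub :=
  ⟨fun x => if x < k then Msg.name x else (s.nm (x - k)).rename (· + k),
    fun a => (s.rg a).rename (· + k)⟩

/-- First `s`, then `t`. -/
def comp (s t : Sub) : Sub := ⟨fun x => (s.nm x).app t, fun a => (s.rg a).app t⟩

@[ext] theorem ext' {s t : Sub} (h₁ : ∀ x, s.nm x = t.nm x) (h₂ : ∀ a, s.rg a = t.rg a) :
    s = t := by
  cases s; cases t
  simp only [mk.injEq]
  exact ⟨funext h₁, funext h₂⟩

end Sub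

namespace Msg

theorem subst_eq_app (σ : ℕ → Msg) (M : Msg) : M.subst σ = M.app (Sub.ofNames σ) := by
  induction M <;> simp_all [subst, app, Sub.ofNames]

theorem rename_eq_app (f : ℕ → ℕ) (M : Msg) :
    M.rename f = M.app (Sub.ofNames fun x => name (f x)) := subst_eq_app _ _

theorem app_app (s t : Sub) (M : Msg) : (M.app s).app t = M.app (s.comp t) := by
  induction M <;> simp_all [app, Sub.comp]

theorem app_congr {s t : Sub} {M : Msg} (h₁ : ∀ x ∈ M.fn, s.nm x = t.nm x)
    (h₂ : ∀ a ∈ M.rn, s.rg a = t.rg a) : M.app s = M.app t := by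
  induction M with
  | name x => exact h₁ x rfl
  | rigid a => exact h₂ a rfl
  | pair M N ihM ihN =>
    simp only [app, pair.injEq]
    exact ⟨ihM (fun x hx => h₁ x (.inl hx)) (fun x hx => h₂ x (.inl hx)),
      ihN (fun x hx => h₁ x (.inr hx)) (fun x hx => h₂ x (.inr hx))⟩
  | enc M N ihM ihN =>
    simp only [app, enc.injEq]
    exact ⟨ihM (fun x hx => h₁ x (.inl hx)) (fun x hx => h₂ x (.inl hx)),
      ihN (fun x hx => h₁ x (.inr hx)) (fun x hx => h₂ x (.inr hx))⟩

/-- The identity substitution. -/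
theorem app_eq_self {s : Sub} {M : Msg} (h₁ : ∀ x ∈ M.fn, s.nm x = name x)
    (h₂ : ∀ a ∈ M.rn, s.rg a = rigid a) : M.app s = M := by
  have h : ∀ M : Msg, M.app ⟨name, rigid⟩ = M := fun M => by induction M <;> simp_all [app]
  rw [app_congr (t := ⟨name, rigid⟩) h₁ h₂, h]

theorem mem_fn_app {s : Sub} {M : Msg} {x : ℕ} :
    x ∈ (M.app s).fn ↔ (∃ y ∈ M.fn, x ∈ (s.nm y).fn) ∨ ∃ a ∈ M.rn, x ∈ (s.rg a).fn := by
  induction M with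
  | name x => simp [app, fn, rn]
  | rigid a => simp [app, fn, rn]
  | pair M N ihM ihN => simp only [app, fn, rn, Set.mem_union, ihM, ihN]; grind
  | enc M N ihM ihN => simp only [app, fn, rn, Set.mem_union, ihM, ihN]; grind

theorem mem_rn_app {s : Sub} {M : Msg} {x : ℕ} :
    x ∈ (M.app s).rn ↔ (∃ y ∈ M.fn, x ∈ (s.nm y).rn) ∨ ∃ a ∈ M.rn, x ∈ (s.rg a).rn := by
  induction M with
  | name x => simp [app, fn, rn]
  | rigid a => simp [app, fn, rn]
  | pair M N ihM ihN => simp only [app, fn, rn, Set.mem_union, ihM, ihN]; grind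
  | enc M N ihM ihN => simp only [app, fn, rn, Set.mem_union, ihM, ihN]; grind

theorem mem_fn_rename {f : ℕ → ℕ} {M : Msg} {x : ℕ} :
    x ∈ (M.rename f).fn ↔ ∃ y ∈ M.fn, x = f y := by
  simp [rename_eq_app, mem_fn_app, Sub.ofNames, fn]

theorem rn_rename (f : ℕ → ℕ) (M : Msg) : (M.rename f).rn = M.rn := by
  ext; simp [rename_eq_app, mem_rn_app, Sub.ofNames, rn]

theorem app_rename (s : Sub) (f : ℕ → ℕ) (M : Msg) :
    (M.rename f).app s = M.app ⟨fun x => s.nm (f x), s.rg⟩ := by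
  rw [rename_eq_app, app_app]; rfl

theorem app_lift_rename (s : Sub) (k : ℕ) (M : Msg) :
    (M.rename (· + k)).app (s.lift k) = (M.app s).rename (· + k) := by
  rw [app_rename, rename_eq_app, app_app]
  congr 1
  ext x
  · simp [Sub.lift, Sub.comp, rename_eq_app]
  · simp [Sub.lift, Sub.comp, rename_eq_app]

end Msg

namespace Sub

theorem lift_nm_lt (s : Sub) {k x : ℕ} (h : x < k) : (s.lift k).nm x = Msg.name x := by
  simp [lift, h]

theorem lift_nm_add (s : Sub) (k x : ℕ) :
    (s.lift k).nm (x + k) = (s.nm x).rename (· + k) := by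
  simp [lift]

theorem lift_nm_ge (s : Sub) {k x : ℕ} (h : k ≤ x) :
    (s.lift k).nm x = (s.nm (x - k)).rename (· + k) := by
  simp [lift, h]

theorem lift_rg (s : Sub) (k a : ℕ) : (s.lift k).rg a = (s.rg a).rename (· + k) := rfl

theorem lift_comp (s t : Sub) (k : ℕ) : (s.comp t).lift k = (s.lift k).comp (t.lift k) := by
  ext x
  · by_cases h : x < k
    · simp [comp, lift, h, Msg.app]
    · have := Msg.app_lift_rename t k (s.nm (x - k))
      simp only [comp, lift, h, if_false] at this ⊢
      exact this.symm
  · exact (Msg.app_lift_rename t k (s.rg x)).symm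

theorem lift_lift (s : Sub) (j k : ℕ) : (s.lift j).lift k = s.lift (j + k) := by
  have h : ∀ M : Msg, (M.rename (· + j)).rename (· + k) = M.rename (· + (j + k)) := fun M => by
    rw [Msg.rename_eq_app (· + k), Msg.app_rename, Msg.rename_eq_app]; simp [ofNames, add_assoc]
  ext x
  · rcases lt_or_ge x k with hx | hx
    · rw [lift_nm_lt _ hx, lift_nm_lt _ (by omega)]
    · rw [lift_nm_ge _ hx]
      rcases lt_or_ge (x - k) j with hy | hy
      · rw [lift_nm_lt _ hy, lift_nm_lt _ (by omega)]
        simp only [Msg.rename, Msg.subst, Msg.name.injEq]; omega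
      · rw [lift_nm_ge _ hy, lift_nm_ge _ (by omega), h]
        congr 2; omega
  · exact h _

theorem lift_zero (s : Sub) : s.lift 0 = s := by
  have h : ∀ M : Msg, M.rename (· + 0) = M := fun M => by
    rw [Msg.rename_eq_app]; exact Msg.app_eq_self (fun _ _ => rfl) (fun _ _ => rfl)
  ext x
  · rw [lift_nm_ge _ (Nat.zero_le x), h]; rfl
  · exact h _

theorem lift_ofNames (σ : ℕ → Msg) : (ofNames σ).lift 1 = ofNames (up σ) := by
  ext x
  · cases x <;> simp [ofNames, lift, up]
  · simp [ofNames, lift, Msg.rename, Msg.subst]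

end Sub

namespace Proc

/-- Application of a substitution of names and rigid names to a process. -/
def app : Sub → Proc → Proc
  | _, nil => nil
  | s, out M N P => out (M.app s) (N.app s) (P.app s)
  | s, inp M P => inp (M.app s) (P.app (s.lift 1))
  | s, par P Q => par (P.app s) (Q.app s)
  | s, res P => res (P.app (s.lift 1))
  | s, rep P => rep (P.app s)
  | s, mat M N P => mat (M.app s) (N.app s) (P.app s)
  | s, letp L P => letp (L.app s) (P.app (s.lift 2))
  | s, dec L N P => dec (L.app s) (N.app s) (P.app (s.lift 1))

theorem subst_eq_app (σ : ℕ → Msg) (P : Proc) : P.subst σ = P.app (Sub.ofNames σ) := by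
  have h2 : ∀ σ, (Sub.ofNames σ).lift 2 = Sub.ofNames (up (up σ)) := fun σ => by
    rw [← Sub.lift_ofNames, ← Sub.lift_ofNames, Sub.lift_lift]
  induction P generalizing σ <;>
    simp_all [subst, app, Msg.subst_eq_app, Sub.lift_ofNames]

theorem rename_eq_app (f : ℕ → ℕ) (P : Proc) :
    P.rename f = P.app (Sub.ofNames fun x => Msg.name (f x)) := subst_eq_app _ _

theorem app_app (s t : Sub) (P : Proc) : (P.app s).app t = P.app (s.comp t) := by
  induction P generalizing s t <;> simp_all [app, Msg.app_app, Sub.lift_comp]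

theorem app_congr {s t : Sub} {P : Proc} (h₁ : ∀ x ∈ P.fn, s.nm x = t.nm x)
    (h₂ : ∀ a ∈ P.rn, s.rg a = t.rg a) : P.app s = P.app t := by
  have hlift : ∀ (k : ℕ) (s t : Sub) (A : Set ℕ), (∀ x, x + k ∈ A → s.nm x = t.nm x) →
      ∀ x ∈ A, (s.lift k).nm x = (t.lift k).nm x := by
    intro k s t A h x hx
    rcases lt_or_ge x k with hk | hk
    · rw [Sub.lift_nm_lt _ hk, Sub.lift_nm_lt _ hk]
    · rw [Sub.lift_nm_ge _ hk, Sub.lift_nm_ge _ hk, h _ (by rwa [Nat.sub_add_cancel hk])]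
  have hM : ∀ (M : Msg) (s t : Sub), (∀ x ∈ M.fn, s.nm x = t.nm x) →
    (∀ a ∈ M.rn, s.rg a = t.rg a) → M.app s = M.app t := fun M s t => Msg.app_congr
  induction P generalizing s t with
  | nil => rfl
  | out M N P ih =>
    simp only [fn, rn, Set.mem_union] at h₁ h₂
    simp only [app, out.injEq]
    exact ⟨hM _ _ _ (by grind) (by grind), hM _ _ _ (by grind) (by grind),
      ih (by grind) (by grind)⟩
  | inp M P ih =>
    simp only [fn, rn, Set.mem_union, Set.mem_ofPred_eq] at h₁ h₂
    simp only [app, inp.injEq]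
    refine ⟨hM _ _ _ (by grind) (by grind), ih (hlift _ _ _ _ (by grind)) ?_⟩
    intro a ha; rw [Sub.lift_rg, Sub.lift_rg, h₂ a (by grind)]
  | par P Q ihP ihQ =>
    simp only [fn, rn, Set.mem_union] at h₁ h₂
    simp only [app, par.injEq]
    exact ⟨ihP (by grind) (by grind), ihQ (by grind) (by grind)⟩
  | res P ih =>
    simp only [fn, rn, Set.mem_ofPred_eq] at h₁ h₂
    simp only [app, res.injEq]
    refine ih (hlift _ _ _ _ h₁) ?_
    intro a ha; rw [Sub.lift_rg, Sub.lift_rg, h₂ a ha]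
  | rep P ih => simp only [app, rep.injEq]; exact ih h₁ h₂
  | mat M N P ih =>
    simp only [fn, rn, Set.mem_union] at h₁ h₂
    simp only [app, mat.injEq]
    exact ⟨hM _ _ _ (by grind) (by grind), hM _ _ _ (by grind) (by grind),
      ih (by grind) (by grind)⟩
  | letp L P ih =>
    simp only [fn, rn, Set.mem_union, Set.mem_ofPred_eq] at h₁ h₂
    simp only [app, letp.injEq]
    refine ⟨hM _ _ _ (by grind) (by grind), ih (hlift _ _ _ _ (by grind)) ?_⟩
    intro a ha; rw [Sub.lift_rg, Sub.lift_rg, h₂ a (by grind)]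
  | dec L N P ih =>
    simp only [fn, rn, Set.mem_union, Set.mem_ofPred_eq] at h₁ h₂
    simp only [app, dec.injEq]
    refine ⟨hM _ _ _ (by grind) (by grind), hM _ _ _ (by grind) (by grind),
      ih (hlift _ _ _ _ (by grind)) ?_⟩
    intro a ha; rw [Sub.lift_rg, Sub.lift_rg, h₂ a (by grind)]

theorem app_eq_self {s : Sub} {P : Proc} (h₁ : ∀ x ∈ P.fn, s.nm x = Msg.name x)
    (h₂ : ∀ a ∈ P.rn, s.rg a = Msg.rigid a) : P.app s = P := by
  have hlift : ∀ k, Sub.lift k ⟨Msg.name, Msg.rigid⟩ = ⟨Msg.name, Msg.rigid⟩ := fun k => by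
    ext x
    · rcases lt_or_ge x k with hk | hk
      · rw [Sub.lift_nm_lt _ hk]
      · rw [Sub.lift_nm_ge _ hk]
        simp only [Msg.rename, Msg.subst, Nat.sub_add_cancel hk]
    · rfl
  have hM : ∀ M : Msg, M.app ⟨Msg.name, Msg.rigid⟩ = M := fun M =>
    Msg.app_eq_self (fun _ _ => rfl) (fun _ _ => rfl)
  have h : ∀ P : Proc, P.app ⟨Msg.name, Msg.rigid⟩ = P := fun P => by
    induction P <;> simp_all [app]
  rw [app_congr (t := ⟨Msg.name, Msg.rigid⟩) h₁ h₂, h]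

theorem mem_fn_app {s : Sub} {P : Proc} {x : ℕ} :
    x ∈ (P.app s).fn ↔ (∃ y ∈ P.fn, x ∈ (s.nm y).fn) ∨ ∃ a ∈ P.rn, x ∈ (s.rg a).fn := by
  have hM : ∀ (M : Msg) (k x : ℕ), x + k ∈ (M.rename (· + k)).fn ↔ x ∈ M.fn := by
    intro M k x; simp [Msg.mem_fn_rename]
  have hlift : ∀ (k : ℕ) (A B : Set ℕ) (s : Sub) (x : ℕ),
      ((∃ y ∈ A, x + k ∈ ((s.lift k).nm y).fn) ∨ ∃ a ∈ B, x + k ∈ ((s.lift k).rg a).fn) ↔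
      ((∃ y ∈ {y | y + k ∈ A}, x ∈ (s.nm y).fn) ∨ ∃ a ∈ B, x ∈ (s.rg a).fn) := by
    intro k A B s x
    simp only [Sub.lift_rg, hM]
    refine or_congr_left ⟨?_, ?_⟩
    · rintro ⟨y, hy, hx⟩
      rcases lt_or_ge y k with hk | hk
      · rw [Sub.lift_nm_lt _ hk] at hx
        simp only [Msg.fn, Set.mem_singleton_iff] at hx; omega
      · rw [Sub.lift_nm_ge _ hk, hM] at hx
        exact ⟨y - k, by simpa [Nat.sub_add_cancel hk] using hy, hx⟩
    · rintro ⟨y, hy, hx⟩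
      exact ⟨y + k, hy, by rwa [Sub.lift_nm_add, hM]⟩
  induction P generalizing s x with
  | nil => simp [app, fn, rn]
  | out M N P ih => simp only [app, fn, rn, Set.mem_union, Msg.mem_fn_app, ih]; grind
  | inp M P ih =>
    have := hlift 1 P.fn P.rn s x
    simp only [app, fn, rn, Set.mem_union, Set.mem_ofPred_eq, Msg.mem_fn_app, ih] at this ⊢
    rw [this]; grind
  | par P Q ihP ihQ => simp only [app, fn, rn, Set.mem_union, ihP, ihQ]; grind
  | res P ih => simp only [app, fn, rn, Set.mem_ofPred_eq, ih]; exact hlift 1 P.fn P.rn s x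
  | rep P ih => simp only [app, fn, rn, ih]
  | mat M N P ih => simp only [app, fn, rn, Set.mem_union, Msg.mem_fn_app, ih]; grind
  | letp L P ih =>
    have := hlift 2 P.fn P.rn s x
    simp only [app, fn, rn, Set.mem_union, Set.mem_ofPred_eq, Msg.mem_fn_app, ih] at this ⊢
    rw [this]; grind
  | dec L N P ih =>
    have := hlift 1 P.fn P.rn s x
    simp only [app, fn, rn, Set.mem_union, Set.mem_ofPred_eq, Msg.mem_fn_app, ih] at this ⊢
    rw [this]; grind

theorem mem_rn_app {s : Sub} {P : Proc} {x : ℕ} :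
    x ∈ (P.app s).rn ↔ (∃ y ∈ P.fn, x ∈ (s.nm y).rn) ∨ ∃ a ∈ P.rn, x ∈ (s.rg a).rn := by
  have hlift : ∀ (k : ℕ) (A B : Set ℕ) (s : Sub) (x : ℕ),
      ((∃ y ∈ A, x ∈ ((s.lift k).nm y).rn) ∨ ∃ a ∈ B, x ∈ ((s.lift k).rg a).rn) ↔
      ((∃ y ∈ {y | y + k ∈ A}, x ∈ (s.nm y).rn) ∨ ∃ a ∈ B, x ∈ (s.rg a).rn) := by
    intro k A B s x
    simp only [Sub.lift_rg, Msg.rn_rename]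
    refine or_congr_left ⟨?_, ?_⟩
    · rintro ⟨y, hy, hx⟩
      rcases lt_or_ge y k with hk | hk
      · rw [Sub.lift_nm_lt _ hk] at hx
        exact hx.elim
      · rw [Sub.lift_nm_ge _ hk, Msg.rn_rename] at hx
        exact ⟨y - k, by simpa [Nat.sub_add_cancel hk] using hy, hx⟩
    · rintro ⟨y, hy, hx⟩
      exact ⟨y + k, hy, by rwa [Sub.lift_nm_add, Msg.rn_rename]⟩
  induction P generalizing s x with
  | nil => simp [app, fn, rn]
  | out M N P ih => simp only [app, fn, rn, Set.mem_union, Msg.mem_rn_app, ih]; grind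
  | inp M P ih =>
    have := hlift 1 P.fn P.rn s x
    simp only [app, fn, rn, Set.mem_union, Set.mem_ofPred_eq, Msg.mem_rn_app, ih] at this ⊢
    rw [this]; grind
  | par P Q ihP ihQ => simp only [app, fn, rn, Set.mem_union, ihP, ihQ]; grind
  | res P ih => simp only [app, fn, rn, ih]; exact hlift 1 P.fn P.rn s x
  | rep P ih => simp only [app, fn, rn, ih]
  | mat M N P ih => simp only [app, fn, rn, Set.mem_union, Msg.mem_rn_app, ih]; grind
  | letp L P ih =>
    have := hlift 2 P.fn P.rn s x
    simp only [app, fn, rn, Set.mem_union, Set.mem_ofPred_eq, Msg.mem_rn_app, ih] at this ⊢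
    rw [this]; grind
  | dec L N P ih =>
    have := hlift 1 P.fn P.rn s x
    simp only [app, fn, rn, Set.mem_union, Set.mem_ofPred_eq, Msg.mem_rn_app, ih] at this ⊢
    rw [this]; grind

theorem app_resN (k : ℕ) (s : Sub) (P : Proc) : (resN k P).app s = resN k (P.app (s.lift k)) := by
  induction k generalizing s with
  | zero => simp [resN, Sub.lift_zero]
  | succ k ih => simp only [resN, app, ih, Sub.lift_lift, add_comm 1 k]

theorem resN_resN (j k : ℕ) (P : Proc) : resN j (resN k P) = resN (j + k) P := by
  induction j with
  | zero => simp [resN]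
  | succ j ih => rw [Nat.add_right_comm]; simp only [resN, ih]

theorem mem_fn_resN {k : ℕ} {P : Proc} {x : ℕ} : x ∈ (resN k P).fn ↔ x + k ∈ P.fn := by
  induction k generalizing x with
  | zero => rfl
  | succ k ih => simp only [resN, fn, Set.mem_ofPred_eq, ih]; rw [Nat.add_right_comm]; rfl

theorem rn_resN (k : ℕ) (P : Proc) : (resN k P).rn = P.rn := by
  induction k with
  | zero => rfl
  | succ k ih => exact ih

end Proc

namespace Action

/-- Application of a substitution of names and rigid names to an action. -/
def app (s : Sub) : Action → Action
  | tau => tau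
  | inp M => inp (M.app s)
  | out M => out (M.app s)

/-- Free names of an action. -/
def fn : Action → Set ℕ
  | tau => ∅
  | inp M => M.fn
  | out M => M.fn

/-- Rigid names of an action. -/
def rn : Action → Set ℕ
  | tau => ∅
  | inp M => M.rn
  | out M => M.rn

theorem app_lift_shift (s : Sub) (α : Action) : α.shift.app (s.lift 1) = (α.app s).shift := by
  cases α <;> simp [shift, app, Msg.app_lift_rename]

end Action

namespace Agent

/-- Application of a substitution of names and rigid names to an agent. -/
def app (s : Sub) : Agent → Agent
  | proc P => proc (P.app s)
  | abs P => abs (P.app (s.lift 1))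
  | conc k M P => conc k (M.app (s.lift k)) (P.app (s.lift k))

/-- Free names of an agent. -/
def fn : Agent → Set ℕ
  | proc P => P.fn
  | abs P => {x | x + 1 ∈ P.fn}
  | conc k M P => {x | x + k ∈ M.fn ∪ P.fn}

/-- Rigid names of an agent. -/
def rn : Agent → Set ℕ
  | proc P => P.rn
  | abs P => P.rn
  | conc _ M P => M.rn ∪ P.rn

end Agent


/-! ## Transitions and substitutions -/

/-- Allowing any `f` that moves free names uniformly from `m` to `n` binders covers both weakenings
and the index permutations of `Agent.res`. Bound names are treated one by one, so that below only
those which occur have to stay bound. -/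
theorem Sub.rename_comp_lift {f : ℕ → ℕ} {m n : ℕ} (s : Sub) (hf : ∀ x, f (x + m) = x + n) :
    (∀ x, (x < m → f x < n) →
      (s.lift n).nm (f x) = ((s.lift m).nm x).rename f) ∧
    ∀ a, (s.lift n).rg a = ((s.lift m).rg a).rename f := by
  have h : ∀ M : Msg, M.rename (· + n) = (M.rename (· + m)).rename f := fun M => by
    rw [Msg.rename_eq_app f, Msg.app_rename, Msg.rename_eq_app]; simp [Sub.ofNames, hf]
  refine ⟨fun x hx => ?_, fun a => h _⟩
  rcases lt_or_ge x m with hm | hm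
  · rw [lift_nm_lt _ hm, lift_nm_lt _ (hx hm)]; rfl
  · obtain ⟨y, rfl⟩ := Nat.exists_eq_add_of_le' hm
    rw [hf, lift_nm_add, lift_nm_add, h]

theorem Msg.app_rename_lift {f : ℕ → ℕ} {m n : ℕ} (s : Sub) (M : Msg)
    (hf : ∀ x, f (x + m) = x + n) (h : ∀ x ∈ M.fn, x < m → f x < n) :
    (M.rename f).app (s.lift n) = (M.app (s.lift m)).rename f := by
  have key := s.rename_comp_lift hf
  rw [rename_eq_app, rename_eq_app, app_app, app_app]
  refine app_congr (fun x hx => ?_) fun a _ => ?_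
  · have := key.1 x (h x hx)
    rwa [rename_eq_app] at this
  · have := key.2 a
    rwa [rename_eq_app] at this

theorem Proc.app_rename_lift {f : ℕ → ℕ} {m n : ℕ} (s : Sub) (P : Proc)
    (hf : ∀ x, f (x + m) = x + n) (h : ∀ x ∈ P.fn, x < m → f x < n) :
    (P.rename f).app (s.lift n) = (P.app (s.lift m)).rename f := by
  have key := s.rename_comp_lift hf
  rw [rename_eq_app, rename_eq_app, app_app, app_app]
  refine app_congr (fun x hx => ?_) fun a _ => ?_
  · have := key.1 x (h x hx)
    rwa [Msg.rename_eq_app] at this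
  · have := key.2 a
    rwa [Msg.rename_eq_app] at this

theorem Proc.app_lift_rename (s : Sub) (k : ℕ) (P : Proc) :
    (P.rename (· + k)).app (s.lift k) = (P.app s).rename (· + k) := by
  rw [app_rename_lift (m := 0) s P (by simp) (by simp), Sub.lift_zero]

/-- The common form of exchanging a substitution with an instantiation of binders: it suffices to
compare the two composites on names and on rigid names. -/
theorem Proc.app_subst (s t : Sub) (σ τ : ℕ → Msg) (P : Proc)
    (h₁ : ∀ x, (σ x).app s = (t.nm x).subst τ) (h₂ : ∀ a, s.rg a = (t.rg a).subst τ) :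
    (P.subst σ).app s = (P.app t).subst τ := by
  rw [subst_eq_app, subst_eq_app, app_app, app_app]
  refine congrArg (P.app ·) ?_
  ext x
  · simpa [Sub.ofNames, Sub.comp, Msg.subst_eq_app] using h₁ x
  · simpa [Sub.ofNames, Sub.comp, Msg.app, Msg.subst_eq_app] using h₂ x

theorem Msg.subst_rename (σ : ℕ → Msg) (f : ℕ → ℕ) (M : Msg) :
    (M.rename f).subst σ = M.subst fun x => σ (f x) := by
  rw [subst_eq_app, app_rename, subst_eq_app]; rfl

theorem Msg.subst_name (M : Msg) : M.subst name = M := by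
  rw [subst_eq_app]; exact app_eq_self (fun _ _ => rfl) (fun _ _ => rfl)

theorem Proc.subst_name (P : Proc) : P.subst Msg.name = P := by
  rw [subst_eq_app]; exact app_eq_self (fun _ _ => rfl) (fun _ _ => rfl)

theorem Proc.app_subst_instUnder (s : Sub) (k : ℕ) (M : Msg) (P : Proc) :
    (P.subst (instUnder k M)).app (s.lift k) =
      (P.app (s.lift 1)).subst (instUnder k (M.app (s.lift k))) := by
  refine app_subst _ _ _ _ _ (fun x => ?_) fun a => ?_
  · cases x with
    | zero => rfl
    | succ x =>
      rw [Sub.lift_nm_add, Msg.subst_rename]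
      simp only [instUnder, Msg.app, Sub.lift_nm_add]; rfl
  · rw [Sub.lift_rg, Sub.lift_rg, Msg.subst_rename]; rfl

theorem Red.app {P Q : Proc} (h : Red P Q) (s : Sub) : Red (P.app s) (Q.app s) := by
  cases h with
  | rep => exact Red.rep _
  | mat => exact Red.mat _ _
  | letp M N P =>
    rw [Proc.app_subst s (s.lift 2) _ (inst2 (M.app s) (N.app s))]
    · exact Red.letp _ _ _
    · rintro (_ | _ | x)
      · rfl
      · rfl
      · rw [Sub.lift_nm_add, Msg.subst_rename]
        exact (Msg.subst_name _).symm
    · intro a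
      rw [Sub.lift_rg, Msg.subst_rename]
      exact (Msg.subst_name _).symm
  | dec M N P =>
    rw [Proc.app_subst s (s.lift 1) _ (inst (M.app s))]
    · exact Red.dec _ _ _
    · rintro (_ | x)
      · rfl
      · rw [Sub.lift_nm_add, Msg.subst_rename]
        exact (Msg.subst_name _).symm
    · intro a
      rw [Sub.lift_rg, Msg.subst_rename]
      exact (Msg.subst_name _).symm

theorem app_interactFC (P : Proc) (k : ℕ) (M : Msg) (Q : Proc) (s : Sub) :
    (interactFC P k M Q).app s =
      interactFC (P.app (s.lift 1)) k (M.app (s.lift k)) (Q.app (s.lift k)) := by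
  simp [interactFC, Proc.app_resN, Proc.app, Proc.app_subst_instUnder]

theorem app_interactCF (P : Proc) (k : ℕ) (M : Msg) (Q : Proc) (s : Sub) :
    (interactCF k M Q P).app s =
      interactCF k (M.app (s.lift k)) (Q.app (s.lift k)) (P.app (s.lift 1)) := by
  simp [interactCF, Proc.app_resN, Proc.app, Proc.app_subst_instUnder]

/-- A lifted substitution neither creates nor removes bound names. Hence the case distinction in
`Agent.res`, whether the restricted name is extruded, is insensitive to substitution. -/
theorem Msg.mem_fn_app_lift {s : Sub} {k n : ℕ} (h : k < n) (M : Msg) :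
    k ∈ (M.app (s.lift n)).fn ↔ k ∈ M.fn := by
  rw [mem_fn_app]
  constructor
  · rintro (⟨y, hy, hk⟩ | ⟨a, _, hk⟩)
    · rcases lt_or_ge y n with hn | hn
      · rw [Sub.lift_nm_lt _ hn] at hk
        cases hk; exact hy
      · rw [Sub.lift_nm_ge _ hn, mem_fn_rename] at hk
        obtain ⟨z, _, hz⟩ := hk; omega
    · rw [Sub.lift_rg, mem_fn_rename] at hk
      obtain ⟨z, _, hz⟩ := hk; omega
  · exact fun hk => .inl ⟨k, hk, by rw [Sub.lift_nm_lt _ h]; rfl⟩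

namespace Agent

theorem app_parRight (A : Agent) (R : Proc) (s : Sub) :
    (A.parRight R).app s = (A.app s).parRight (R.app s) := by
  cases A <;> simp [parRight, app, Proc.app, Proc.app_lift_rename]

theorem app_parLeft (A : Agent) (R : Proc) (s : Sub) :
    (A.parLeft R).app s = (A.app s).parLeft (R.app s) := by
  cases A <;> simp [parLeft, app, Proc.app, Proc.app_lift_rename]

theorem res_conc_of_mem {k : ℕ} {M : Msg} (P : Proc) (h : k ∈ M.fn) :
    (conc k M P).res = conc (k + 1) M P := by
  simp [res, h]

theorem res_conc_of_not_mem {k : ℕ} {M : Msg} (P : Proc) (h : k ∉ M.fn) :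
    (conc k M P).res = conc k (M.rename fun i => if i < k then i else i - 1)
      (P.rename fun i => if i < k then i + 1 else if i = k then 0 else i).res := by
  simp [res, h]

theorem app_res (A : Agent) (s : Sub) : A.res.app s = (A.app (s.lift 1)).res := by
  cases A with
  | proc P => rfl
  | abs P =>
    simp only [res, app, Proc.app, Sub.lift_lift]
    rw [Proc.app_rename_lift (m := 1 + 1)]
    · intro x; simp
    · intro x _ hx
      have : x = 0 ∨ x = 1 := by omega
      rcases this with rfl | rfl <;> simp
  | conc k M P =>
    have hk := Msg.mem_fn_app_lift (s := s) (show k < 1 + k by omega) M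
    by_cases h : k ∈ M.fn
    · simp only [app, Sub.lift_lift, res_conc_of_mem _ h, res_conc_of_mem _ (hk.2 h)]
      rw [add_comm 1 k]
    · simp only [app, Sub.lift_lift, res_conc_of_not_mem _ h,
        res_conc_of_not_mem _ (fun e => h (hk.1 e)), Proc.app]
      rw [Proc.app_rename_lift (m := 1 + k), Msg.app_rename_lift (m := 1 + k)]
      · intro x; split_ifs <;> omega
      · intro x hx hxk
        have : x ≠ k := fun e => h (e ▸ hx)
        split_ifs <;> omega
      · intro x; split_ifs <;> omega
      · intro x _ hxk; split_ifs <;> omega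

end Agent

/-- The rules contain no negative tests, so arbitrary substitutions preserve transitions;
injectivity is needed only to reflect them. -/
theorem Step.app {P : Proc} {α : Action} {A : Agent} (h : Step P α A) (s : Sub) :
    Step (P.app s) (α.app s) (A.app s) := by
  induction h generalizing s with
  | inp M P => exact Step.inp _ _
  | out M N P =>
    simp only [Agent.app, Sub.lift_zero]
    exact Step.out _ _ _
  | commFC _ _ ih₁ ih₂ =>
    simp only [Agent.app, app_interactFC]
    exact Step.commFC (ih₁ s) (ih₂ s)
  | commCF _ _ ih₁ ih₂ =>
    simp only [Agent.app, app_interactCF]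
    exact Step.commCF (ih₁ s) (ih₂ s)
  | red hr _ ih => exact Step.red (hr.app s) (ih s)
  | parL _ ih => rw [Agent.app_parRight]; exact Step.parL (ih s)
  | parR _ ih => rw [Agent.app_parLeft]; exact Step.parR (ih s)
  | res _ ih =>
    rw [Agent.app_res]
    refine Step.res ?_
    rw [← Action.app_lift_shift]
    exact ih _

/-! ### Names of derivatives -/

namespace Proc

theorem mem_fn_subst {σ : ℕ → Msg} {P : Proc} {x : ℕ} :
    x ∈ (P.subst σ).fn ↔ ∃ y ∈ P.fn, x ∈ (σ y).fn := by
  simp [subst_eq_app, mem_fn_app, Sub.ofNames, Msg.fn]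

theorem mem_rn_subst {σ : ℕ → Msg} {P : Proc} {x : ℕ} :
    x ∈ (P.subst σ).rn ↔ (∃ y ∈ P.fn, x ∈ (σ y).rn) ∨ x ∈ P.rn := by
  simp [subst_eq_app, mem_rn_app, Sub.ofNames, Msg.rn]

theorem mem_fn_rename {f : ℕ → ℕ} {P : Proc} {x : ℕ} :
    x ∈ (P.rename f).fn ↔ ∃ y ∈ P.fn, x = f y := by
  simp [rename, mem_fn_subst, Msg.fn]

theorem rn_rename (f : ℕ → ℕ) (P : Proc) : (P.rename f).rn = P.rn := by
  ext; simp [rename, mem_rn_subst, Msg.rn]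

end Proc

theorem Msg.mem_fn_subst {σ : ℕ → Msg} {M : Msg} {x : ℕ} :
    x ∈ (M.subst σ).fn ↔ ∃ y ∈ M.fn, x ∈ (σ y).fn := by
  simp [subst_eq_app, mem_fn_app, Sub.ofNames, fn]

theorem Red.fn_rn {P Q : Proc} (h : Red P Q) : Q.fn ⊆ P.fn ∧ Q.rn ⊆ P.rn := by
  cases h with
  | rep => simp [Proc.fn, Proc.rn]
  | mat => simp only [Proc.fn, Proc.rn]; exact ⟨fun x hx => .inr hx, fun x hx => .inr hx⟩
  | letp M N P =>
    refine ⟨fun x hx => ?_, fun x hx => ?_⟩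
    · obtain ⟨y, hy, hx⟩ := Proc.mem_fn_subst.1 hx
      rcases y with _ | _ | y
      · exact .inl (.inr hx)
      · exact .inl (.inl hx)
      · cases hx; exact .inr hy
    · rcases Proc.mem_rn_subst.1 hx with ⟨y, hy, hx⟩ | hx
      · rcases y with _ | _ | y
        · exact .inl (.inr hx)
        · exact .inl (.inl hx)
        · cases hx
      · exact .inr hx
  | dec M N P =>
    refine ⟨fun x hx => ?_, fun x hx => ?_⟩
    · obtain ⟨y, hy, hx⟩ := Proc.mem_fn_subst.1 hx
      rcases y with _ | y
      · exact .inl (.inl (.inl hx))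
      · cases hx; exact .inr hy
    · rcases Proc.mem_rn_subst.1 hx with ⟨y, hy, hx⟩ | hx
      · rcases y with _ | y
        · exact .inl (.inl (.inl hx))
        · cases hx
      · exact .inr hx

theorem Proc.fn_rn_subst_instUnder (P : Proc) (k : ℕ) (M : Msg) :
    (∀ x, x + k ∈ (P.subst (instUnder k M)).fn → x + 1 ∈ P.fn ∨ x + k ∈ M.fn) ∧
      (P.subst (instUnder k M)).rn ⊆ P.rn ∪ M.rn := by
  refine ⟨fun x hx => ?_, fun x hx => ?_⟩
  · obtain ⟨y, hy, hx⟩ := mem_fn_subst.1 hx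
    rcases y with _ | y
    · exact .inr hx
    · simp only [instUnder, Msg.fn, Set.mem_singleton_iff, Nat.add_right_cancel_iff] at hx
      subst hx; exact .inl hy
  · rcases mem_rn_subst.1 hx with ⟨y, hy, hx⟩ | hx
    · rcases y with _ | y
      · exact .inr hx
      · cases hx
    · exact .inl hx

theorem Agent.fn_rn_res (A : Agent) :
    (∀ x ∈ A.res.fn, x + 1 ∈ A.fn) ∧ A.res.rn ⊆ A.rn := by
  cases A with
  | proc P => exact ⟨fun x hx => hx, subset_rfl⟩
  | abs P =>
    refine ⟨fun x hx => ?_, ?_⟩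
    · obtain ⟨y, hy, hx⟩ := Proc.mem_fn_rename.1 hx
      have : y = x + 2 := by split_ifs at hx <;> omega
      subst this; exact hy
    · simp only [res, rn, Proc.rn, Proc.rn_rename]; rfl
  | conc k M P =>
    simp only [res]
    split_ifs with h
    · refine ⟨fun x hx => ?_, subset_rfl⟩
      simp only [fn, Set.mem_ofPred_eq] at hx ⊢
      rwa [Nat.add_right_comm]
    · refine ⟨fun x hx => ?_, ?_⟩
      · simp only [fn, Proc.fn, Set.mem_ofPred_eq, Set.mem_union, Msg.mem_fn_rename,
          Proc.mem_fn_rename] at hx ⊢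
        rcases hx with ⟨y, hy, hx⟩ | ⟨y, hy, hx⟩
        · have hyk : y ≠ k := fun e => h (e ▸ hy)
          have : y = x + 1 + k := by split_ifs at hx <;> omega
          subst this; exact .inl hy
        · have : y = x + 1 + k := by split_ifs at hx <;> omega
          subst this; exact .inr hy
      · simp only [rn, Proc.rn, Proc.rn_rename, Msg.rn_rename]; rfl

theorem Agent.fn_rn_parRight (A : Agent) (R : Proc) :
    (A.parRight R).fn ⊆ A.fn ∪ R.fn ∧ (A.parRight R).rn ⊆ A.rn ∪ R.rn := by
  cases A with
  | proc P => exact ⟨subset_rfl, subset_rfl⟩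
  | abs P =>
    simp only [parRight, fn, rn, Proc.fn, Proc.rn, Proc.rn_rename]
    refine ⟨fun x hx => ?_, subset_rfl⟩
    simpa [Proc.mem_fn_rename] using hx
  | conc k M P =>
    simp only [parRight, fn, rn, Proc.fn, Proc.rn, Proc.rn_rename]
    refine ⟨fun x hx => ?_, by rw [Set.union_assoc]⟩
    simpa [Proc.mem_fn_rename, or_assoc] using hx

theorem Agent.fn_rn_parLeft (A : Agent) (R : Proc) :
    (A.parLeft R).fn ⊆ R.fn ∪ A.fn ∧ (A.parLeft R).rn ⊆ R.rn ∪ A.rn := by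
  cases A with
  | proc P => exact ⟨subset_rfl, subset_rfl⟩
  | abs P =>
    simp only [parLeft, fn, rn, Proc.fn, Proc.rn, Proc.rn_rename]
    refine ⟨fun x hx => ?_, subset_rfl⟩
    simpa [Proc.mem_fn_rename] using hx
  | conc k M P =>
    simp only [parLeft, fn, rn, Proc.fn, Proc.rn, Proc.rn_rename]
    refine ⟨fun x hx => ?_, by rw [Set.union_left_comm]⟩
    simpa [Proc.mem_fn_rename, or_left_comm] using hx

/-- Transitions only transport messages already present. This makes renamings invertible along
transitions and keeps fresh names fresh for the derivatives. -/
theorem Step.fn_rn {P : Proc} {α : Action} {A : Agent} (h : Step P α A) :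
    (α.fn ⊆ P.fn ∧ α.rn ⊆ P.rn) ∧ A.fn ⊆ P.fn ∧ A.rn ⊆ P.rn := by
  induction h with
  | inp M P =>
    simp only [Action.fn, Action.rn, Agent.fn, Agent.rn, Proc.fn, Proc.rn]
    simp
  | out M N P =>
    simp only [Action.fn, Action.rn, Agent.fn, Agent.rn, Proc.fn, Proc.rn]
    refine ⟨⟨fun x hx => .inl (.inl hx), fun x hx => .inl (.inl hx)⟩, ?_, ?_⟩
    · rintro x (hx | hx)
      · exact .inl (.inr hx)
      · exact .inr hx
    · rintro x (hx | hx)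
      · exact .inl (.inr hx)
      · exact .inr hx
  | @commFC P Q P' Q' M N k _ _ ih₁ ih₂ =>
    refine ⟨⟨fun x hx => hx.elim, fun x hx => hx.elim⟩, fun x hx => ?_, fun x hx => ?_⟩
    · have hx : x + k ∈ ((P'.subst (instUnder k N)).par Q').fn := Proc.mem_fn_resN.1 hx
      rcases hx with hx | hx
      · rcases (P'.fn_rn_subst_instUnder k N).1 x hx with hx | hx
        · exact .inl (ih₁.2.1 hx)
        · exact .inr (ih₂.2.1 (.inl hx))
      · exact .inr (ih₂.2.1 (.inr hx))
    · have hx : x ∈ ((P'.subst (instUnder k N)).par Q').rn := by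
        simpa only [Agent.rn, interactFC, Proc.rn_resN] using hx
      rcases hx with hx | hx
      · rcases (P'.fn_rn_subst_instUnder k N).2 hx with hx | hx
        · exact .inl (ih₁.2.2 hx)
        · exact .inr (ih₂.2.2 (.inl hx))
      · exact .inr (ih₂.2.2 (.inr hx))
  | @commCF P Q P' Q' M N k _ _ ih₁ ih₂ =>
    refine ⟨⟨fun x hx => hx.elim, fun x hx => hx.elim⟩, fun x hx => ?_, fun x hx => ?_⟩
    · have hx : x + k ∈ (P'.par (Q'.subst (instUnder k N))).fn := Proc.mem_fn_resN.1 hx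
      rcases hx with hx | hx
      · exact .inl (ih₁.2.1 (.inr hx))
      · rcases (Q'.fn_rn_subst_instUnder k N).1 x hx with hx | hx
        · exact .inr (ih₂.2.1 hx)
        · exact .inl (ih₁.2.1 (.inl hx))
    · have hx : x ∈ (P'.par (Q'.subst (instUnder k N))).rn := by
        simpa only [Agent.rn, interactCF, Proc.rn_resN] using hx
      rcases hx with hx | hx
      · exact .inl (ih₁.2.2 (.inr hx))
      · rcases (Q'.fn_rn_subst_instUnder k N).2 hx with hx | hx
        · exact .inr (ih₂.2.2 hx)
        · exact .inl (ih₁.2.2 (.inl hx))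
  | red hr _ ih =>
    have := hr.fn_rn
    exact ⟨⟨ih.1.1.trans this.1, ih.1.2.trans this.2⟩, ih.2.1.trans this.1, ih.2.2.trans this.2⟩
  | @parL P Q α A _ ih =>
    have := A.fn_rn_parRight Q
    exact ⟨⟨fun x hx => .inl (ih.1.1 hx), fun x hx => .inl (ih.1.2 hx)⟩,
      this.1.trans (Set.union_subset_union_left _ ih.2.1),
      this.2.trans (Set.union_subset_union_left _ ih.2.2)⟩
  | @parR P Q α A _ ih =>
    have := A.fn_rn_parLeft P
    exact ⟨⟨fun x hx => .inr (ih.1.1 hx), fun x hx => .inr (ih.1.2 hx)⟩,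
      this.1.trans (Set.union_subset_union_right _ ih.2.1),
      this.2.trans (Set.union_subset_union_right _ ih.2.2)⟩
  | @res P α A _ ih =>
    refine ⟨?_, fun x hx => ih.2.1 (A.fn_rn_res.1 x hx), A.fn_rn_res.2.trans ih.2.2⟩
    cases α with
    | tau => exact ⟨fun x hx => hx.elim, fun x hx => hx.elim⟩
    | inp M =>
      simp only [Action.shift, Action.fn, Action.rn, Msg.rn_rename] at ih
      exact ⟨fun x hx => ih.1.1 (Msg.mem_fn_rename.2 ⟨x, hx, rfl⟩), ih.1.2⟩
    | out M =>
      simp only [Action.shift, Action.fn, Action.rn, Msg.rn_rename] at ih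
      exact ⟨fun x hx => ih.1.1 (Msg.mem_fn_rename.2 ⟨x, hx, rfl⟩), ih.1.2⟩


/-! ## Observer theories -/

theorem Msg.fn_finite (M : Msg) : M.fn.Finite := by
  induction M with
  | name x => exact Set.finite_singleton x
  | rigid a => exact Set.finite_empty
  | pair M N ihM ihN => exact ihM.union ihN
  | enc M N ihM ihN => exact ihM.union ihN

namespace Theory

/-- Free names of a theory. -/
def fn (Γ : Theory) : Set ℕ := {x | ∃ p ∈ Γ, x ∈ p.1.fn ∪ p.2.fn}

/-- The theory `Γ` seen from under `k` more binders. -/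
def shift (k : ℕ) (Γ : Theory) : Theory :=
  {p | ∃ q ∈ Γ, p = (q.1.rename (· + k), q.2.rename (· + k))}

theorem pi1_insert (Γ : Theory) (M N : Msg) : pi1 (insert (M, N) Γ) = insert M (pi1 Γ) := by
  ext X; simp [pi1, exists_or]

theorem pi2_insert (Γ : Theory) (M N : Msg) : pi2 (insert (M, N) Γ) = insert N (pi2 Γ) := by
  ext X; simp [pi2, exists_or]

theorem fn_insert_insert_pair {Γ : Theory} {M₁ N₁ M₂ N₂ : Msg}
    (h : (Msg.pair M₁ N₁, Msg.pair M₂ N₂) ∈ Γ) :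
    fn (insert (M₁, M₂) (insert (N₁, N₂) Γ)) ⊆ fn Γ := by
  rintro x ⟨p, rfl | rfl | hp, hx⟩
  · exact ⟨_, h, hx.imp Or.inl Or.inl⟩
  · exact ⟨_, h, hx.imp Or.inr Or.inr⟩
  · exact ⟨_, hp, hx⟩

theorem fn_insert_insert_enc {Γ : Theory} {M₁ N₁ M₂ N₂ : Msg}
    (h : (Msg.enc M₁ N₁, Msg.enc M₂ N₂) ∈ Γ) :
    fn (insert (M₁, M₂) (insert (N₁, N₂) Γ)) ⊆ fn Γ := by
  rintro x ⟨p, rfl | rfl | hp, hx⟩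
  · exact ⟨_, h, hx.imp Or.inl Or.inl⟩
  · exact ⟨_, h, hx.imp Or.inr Or.inr⟩
  · exact ⟨_, hp, hx⟩

end Theory

namespace Entails

theorem mono {Γ Δ : Theory} {M N : Msg} (h : Entails Γ M N) (hΔ : Γ ⊆ Δ) : Entails Δ M N := by
  induction h generalizing Δ with
  | var x => exact var x
  | id h => exact id (hΔ h)
  | pr _ _ ih₁ ih₂ => exact pr (ih₁ hΔ) (ih₂ hΔ)
  | er _ _ ih₁ ih₂ => exact er (ih₁ hΔ) (ih₂ hΔ)
  | pl h _ ih =>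
    exact pl (hΔ h) (ih (Set.insert_subset_insert (Set.insert_subset_insert hΔ)))
  | el h _ _ ih₁ ih₂ =>
    exact el (hΔ h) (ih₁ hΔ) (ih₂ (Set.insert_subset_insert (Set.insert_subset_insert hΔ)))

theorem subset_insert_insert {Γ : Theory} (p q : Msg × Msg) : Γ ⊆ insert p (insert q Γ) :=
  (Set.subset_insert _ _).trans (Set.subset_insert _ _)

/-- A pair not built by `pr` comes from the theory, where `pl` opens it; the left rules commute with
the conclusion. -/
theorem pair_inv {Γ : Theory} {M N M' N' : Msg}
    (h : Entails Γ (Msg.pair M N) (Msg.pair M' N')) : Entails Γ M M' ∧ Entails Γ N N' := by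
  generalize hX : Msg.pair M N = X at h
  generalize hY : Msg.pair M' N' = Y at h
  induction h with
  | var x => cases hX
  | id h =>
    subst hX hY
    exact ⟨pl h (id (.inl rfl)), pl h (id (.inr (.inl rfl)))⟩
  | pr h₁ h₂ => cases hX; cases hY; exact ⟨h₁, h₂⟩
  | er => cases hX
  | pl h _ ih => exact ⟨pl h (ih hX hY).1, pl h (ih hX hY).2⟩
  | el h h' _ _ ih => exact ⟨el h h' (ih hX hY).1, el h h' (ih hX hY).2⟩

/-- As for pairs, except that `el` needs the keys to be entailed. This assumption is weakened along
the left rules, which enlarge the theory. -/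
theorem enc_inv {Γ : Theory} {M N M' N' : Msg}
    (h : Entails Γ (Msg.enc M N) (Msg.enc M' N')) (hN : Entails Γ N N') : Entails Γ M M' := by
  generalize hX : Msg.enc M N = X at h
  generalize hY : Msg.enc M' N' = Y at h
  induction h with
  | var x => cases hX
  | id h =>
    subst hX hY
    exact el h hN (id (.inl rfl))
  | pr => cases hX
  | er h₁ h₂ => cases hX; cases hY; exact h₁
  | pl h _ ih => exact pl h (ih (hN.mono (subset_insert_insert _ _)) hX hY)
  | el h h' _ _ ih => exact el h h' (ih (hN.mono (subset_insert_insert _ _)) hX hY)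

/-- Entailment is preserved by a pair of substitutions that maps the names which occur to
entailed pairs. -/
theorem subst_of_mem {Γ Δ : Theory} {M N : Msg} {σ τ : ℕ → Msg} (h : Entails Γ M N)
    (hn : ∀ x ∈ Γ.fn ∪ (M.fn ∪ N.fn), Entails Δ (σ x) (τ x))
    (hΓ : ∀ p ∈ Γ, Entails Δ (p.1.subst σ) (p.2.subst τ)) :
    Entails Δ (M.subst σ) (N.subst τ) := by
  induction h with
  | var x => exact hn x (.inr (.inl rfl))
  | id h => exact hΓ _ h
  | pr _ _ ih₁ ih₂ =>
    refine pr (ih₁ (fun x hx => hn x ?_) hΓ) (ih₂ (fun x hx => hn x ?_) hΓ)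
    · exact hx.imp_right (Or.imp Or.inl Or.inl)
    · exact hx.imp_right (Or.imp Or.inr Or.inr)
  | er _ _ ih₁ ih₂ =>
    refine er (ih₁ (fun x hx => hn x ?_) hΓ) (ih₂ (fun x hx => hn x ?_) hΓ)
    · exact hx.imp_right (Or.imp Or.inl Or.inl)
    · exact hx.imp_right (Or.imp Or.inr Or.inr)
  | pl h _ ih =>
    have := pair_inv (hΓ _ h)
    refine ih (fun x hx => hn x (hx.imp_left fun e => Theory.fn_insert_insert_pair h e)) ?_
    rintro p (rfl | rfl | hp)
    · exact this.1
    · exact this.2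
    · exact hΓ _ hp
  | el h _ _ ih₁ ih₂ =>
    -- The keys occur in a pair of the theory, so `hn` covers their names. Their images are
    -- entailed, which is what opening the image of the ciphertext requires.
    have hk := ih₁ (fun x hx => hn x (.inl (hx.elim _root_.id
      fun e => ⟨_, h, e.imp Or.inr Or.inr⟩))) hΓ
    have := enc_inv (hΓ _ h) hk
    refine ih₂ (fun x hx => hn x (hx.imp_left fun e => Theory.fn_insert_insert_enc h e)) ?_
    rintro p (rfl | rfl | hp)
    · exact this
    · exact hk
    · exact hΓ _ hp

theorem subst {Γ Δ : Theory} {M N : Msg} {σ τ : ℕ → Msg} (h : Entails Γ M N)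
    (hn : ∀ x, Entails Δ (σ x) (τ x)) (hΓ : ∀ p ∈ Γ, Entails Δ (p.1.subst σ) (p.2.subst τ)) :
    Entails Δ (M.subst σ) (N.subst τ) :=
  h.subst_of_mem (fun x _ => hn x) hΓ

/-- Cut is the case of the identity substitution. -/
theorem cut {Γ Δ : Theory} {M N : Msg} (h : Entails Γ M N)
    (hΓ : ∀ p ∈ Γ, Entails Δ p.1 p.2) : Entails Δ M N := by
  have := h.subst (σ := Msg.name) (τ := Msg.name) (Δ := Δ) var
    (by simpa only [Msg.subst_name] using hΓ)
  simpa only [Msg.subst_name] using this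

theorem shift {Γ : Theory} {M N : Msg} (h : Entails Γ M N) (k : ℕ) :
    Entails (Γ.shift k) (M.rename (· + k)) (N.rename (· + k)) :=
  h.subst (fun _ => var _) fun p hp => id ⟨p, hp, rfl⟩

/-- A name foreign to the theory enters a derivation only through `var`, which puts it on both
sides. -/
theorem mem_fn_iff {Γ : Theory} {M N : Msg} (h : Entails Γ M N) {x : ℕ} (hx : x ∉ Γ.fn) :
    x ∈ M.fn ↔ x ∈ N.fn := by
  induction h with
  | var => rfl
  | id h => exact ⟨fun e => (hx ⟨_, h, .inl e⟩).elim, fun e => (hx ⟨_, h, .inr e⟩).elim⟩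
  | pr _ _ ih₁ ih₂ => exact or_congr (ih₁ hx) (ih₂ hx)
  | er _ _ ih₁ ih₂ => exact or_congr (ih₁ hx) (ih₂ hx)
  | pl h _ ih => exact ih fun e => hx (Theory.fn_insert_insert_pair h e)
  | el h _ _ _ ih => exact ih fun e => hx (Theory.fn_insert_insert_enc h e)

/-- No rule introduces a rigid name, so observers know only the rigid names of the trace. -/
theorem rn_subset {Γ : Theory} {M N : Msg} {T : Set ℕ} (h : Entails Γ M N)
    (hT : ∀ p ∈ Γ, p.1.rn ∪ p.2.rn ⊆ T) : M.rn ∪ N.rn ⊆ T := by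
  induction h with
  | var => simp [Msg.rn]
  | id h => exact hT _ h
  | pr _ _ ih₁ ih₂ =>
    have h₁ := ih₁ hT
    have h₂ := ih₂ hT
    simp only [Msg.rn, Set.union_subset_iff] at h₁ h₂ ⊢
    tauto
  | er _ _ ih₁ ih₂ =>
    have h₁ := ih₁ hT
    have h₂ := ih₂ hT
    simp only [Msg.rn, Set.union_subset_iff] at h₁ h₂ ⊢
    tauto
  | pl h _ ih =>
    refine ih ?_
    have := hT _ h
    simp only [Msg.rn, Set.union_subset_iff] at this
    rintro p (rfl | rfl | hp)
    · exact Set.union_subset this.1.1 this.2.1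
    · exact Set.union_subset this.1.2 this.2.2
    · exact hT _ hp
  | el h _ _ _ ih =>
    refine ih ?_
    have := hT _ h
    simp only [Msg.rn, Set.union_subset_iff] at this
    rintro p (rfl | rfl | hp)
    · exact Set.union_subset this.1.1 this.2.1
    · exact Set.union_subset this.1.2 this.2.2
    · exact hT _ hp

theorem refl_of_pure {Γ : Theory} {M : Msg} (h : M.Pure) : Entails Γ M M := by
  induction M with
  | name x => exact var x
  | rigid a => simp [Msg.Pure, Msg.rn] at h
  | pair M N ihM ihN =>
    simp only [Msg.Pure, Msg.rn, Set.union_empty_iff] at h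
    exact pr (ihM h.1) (ihN h.2)
  | enc M N ihM ihN =>
    simp only [Msg.Pure, Msg.rn, Set.union_empty_iff] at h
    exact er (ihM h.1) (ihN h.2)

end Entails

/-! ### Synthesis on one side -/

namespace Synth

theorem mono {S T : Set Msg} {M : Msg} (h : Synth S M) (hT : S ⊆ T) : Synth T M := by
  induction h generalizing T with
  | var x => exact var x
  | id h => exact id (hT h)
  | pr _ _ ih₁ ih₂ => exact pr (ih₁ hT) (ih₂ hT)
  | er _ _ ih₁ ih₂ => exact er (ih₁ hT) (ih₂ hT)
  | pl h _ ih =>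
    exact pl (hT h) (ih (Set.insert_subset_insert (Set.insert_subset_insert hT)))
  | el h _ _ ih₁ ih₂ =>
    exact el (hT h) (ih₁ hT) (ih₂ (Set.insert_subset_insert (Set.insert_subset_insert hT)))

theorem pair_inv {S : Set Msg} {M N : Msg} (h : Synth S (Msg.pair M N)) :
    Synth S M ∧ Synth S N := by
  generalize hX : Msg.pair M N = X at h
  induction h with
  | var x => cases hX
  | id h =>
    subst hX
    exact ⟨pl h (id (.inl rfl)), pl h (id (.inr (.inl rfl)))⟩
  | pr h₁ h₂ => cases hX; exact ⟨h₁, h₂⟩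
  | er => cases hX
  | pl h _ ih => exact ⟨pl h (ih hX).1, pl h (ih hX).2⟩
  | el h h' _ _ ih => exact ⟨el h h' (ih hX).1, el h h' (ih hX).2⟩

theorem enc_inv {S : Set Msg} {M N : Msg} (h : Synth S (Msg.enc M N)) (hN : Synth S N) :
    Synth S M := by
  have hS : ∀ (S : Set Msg) (M N : Msg), S ⊆ insert M (insert N S) := fun S M N =>
    (Set.subset_insert _ _).trans (Set.subset_insert _ _)
  generalize hX : Msg.enc M N = X at h
  induction h with
  | var x => cases hX
  | id h =>
    subst hX
    exact el h hN (id (.inl rfl))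
  | pr => cases hX
  | er h₁ h₂ => cases hX; exact h₁
  | pl h _ ih => exact pl h (ih (hN.mono (hS _ _ _)) hX)
  | el h h' _ _ ih => exact el h h' (ih (hN.mono (hS _ _ _)) hX)

theorem subst {S T : Set Msg} {M : Msg} {σ : ℕ → Msg} (h : Synth S M)
    (hn : ∀ x, Synth T (σ x)) (hS : ∀ N ∈ S, Synth T (N.subst σ)) : Synth T (M.subst σ) := by
  induction h with
  | var x => exact hn x
  | id h => exact hS _ h
  | pr _ _ ih₁ ih₂ => exact pr (ih₁ hS) (ih₂ hS)
  | er _ _ ih₁ ih₂ => exact er (ih₁ hS) (ih₂ hS)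
  | pl h _ ih =>
    have := pair_inv (hS _ h)
    refine ih ?_
    rintro p (rfl | rfl | hp)
    · exact this.1
    · exact this.2
    · exact hS _ hp
  | el h _ _ ih₁ ih₂ =>
    have := enc_inv (hS _ h) (ih₁ hS)
    refine ih₂ ?_
    rintro p (rfl | rfl | hp)
    · exact this
    · exact ih₁ hS
    · exact hS _ hp

theorem cut {S T : Set Msg} {M : Msg} (h : Synth S M) (hS : ∀ N ∈ S, Synth T N) :
    Synth T M := by
  have := h.subst (σ := Msg.name) (T := T) var (by simpa only [Msg.subst_name] using hS)
  simpa only [Msg.subst_name] using this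

end Synth

/-- Each rule projects to its one-sided version. This supplies the synthesis premises of the key
clause and of the input and output clauses of a bisimulation. -/
theorem Entails.synth {Γ : Theory} {M N : Msg} (h : Entails Γ M N) :
    Synth Γ.pi1 M ∧ Synth Γ.pi2 N := by
  induction h with
  | var x => exact ⟨.var x, .var x⟩
  | id h => exact ⟨.id ⟨_, h⟩, .id ⟨_, h⟩⟩
  | pr _ _ ih₁ ih₂ => exact ⟨.pr ih₁.1 ih₂.1, .pr ih₁.2 ih₂.2⟩
  | er _ _ ih₁ ih₂ => exact ⟨.er ih₁.1 ih₂.1, .er ih₁.2 ih₂.2⟩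
  | pl h _ ih =>
    rw [Theory.pi1_insert, Theory.pi1_insert, Theory.pi2_insert, Theory.pi2_insert] at ih
    exact ⟨.pl ⟨_, h⟩ ih.1, .pl ⟨_, h⟩ ih.2⟩
  | el h _ _ ih₁ ih =>
    rw [Theory.pi1_insert, Theory.pi1_insert, Theory.pi2_insert, Theory.pi2_insert] at ih
    exact ⟨.el ⟨_, h⟩ ih₁.1 ih.1, .el ⟨_, h⟩ ih₁.2 ih.2⟩

/-! ### Theories under binders and closure properties of consistency -/

namespace Theory

theorem shift_shift (j k : ℕ) (Γ : Theory) : (Γ.shift j).shift k = Γ.shift (j + k) := by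
  have h : ∀ M : Msg, (M.rename (· + j)).rename (· + k) = M.rename (· + (j + k)) := fun M => by
    rw [Msg.rename, Msg.subst_rename, Msg.rename]; simp only [add_assoc]
  ext p
  constructor
  · rintro ⟨_, ⟨q, hq, rfl⟩, rfl⟩
    exact ⟨q, hq, by simp only [h]⟩
  · rintro ⟨q, hq, rfl⟩
    exact ⟨_, ⟨q, hq, rfl⟩, by simp only [h]⟩

theorem shift_zero (Γ : Theory) : Γ.shift 0 = Γ := by
  have h : ∀ M : Msg, M.rename (fun x => x) = M := Msg.subst_name
  ext p; simp [shift, h]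

theorem not_mem_fn_shift {x k : ℕ} (h : x < k) (Γ : Theory) : x ∉ (Γ.shift k).fn := by
  rintro ⟨_, ⟨q, _, rfl⟩, hx⟩
  simp only [Msg.mem_fn_rename, Set.mem_union] at hx
  rcases hx with ⟨y, _, hy⟩ | ⟨y, _, hy⟩ <;> omega

theorem fn_shift_finite {Γ : Theory} (h : Γ.fn.Finite) (k : ℕ) : (Γ.shift k).fn.Finite := by
  refine (h.image (· + k)).subset ?_
  rintro x ⟨_, ⟨q, hq, rfl⟩, hx⟩
  simp only [Msg.mem_fn_rename, Set.mem_union] at hx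
  rcases hx with ⟨y, hy, rfl⟩ | ⟨y, hy, rfl⟩
  · exact ⟨y, ⟨q, hq, .inl hy⟩, rfl⟩
  · exact ⟨y, ⟨q, hq, .inr hy⟩, rfl⟩

theorem pi1_shift (k : ℕ) (Γ : Theory) : (Γ.shift k).pi1 = Msg.rename (· + k) '' Γ.pi1 := by
  ext M
  constructor
  · rintro ⟨N, q, hq, h⟩
    cases h
    exact ⟨_, ⟨_, hq⟩, rfl⟩
  · rintro ⟨_, ⟨N, hq⟩, rfl⟩
    exact ⟨_, _, hq, rfl⟩

theorem pi2_shift (k : ℕ) (Γ : Theory) : (Γ.shift k).pi2 = Msg.rename (· + k) '' Γ.pi2 := by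
  ext M
  constructor
  · rintro ⟨N, q, hq, h⟩
    cases h
    exact ⟨_, ⟨_, hq⟩, rfl⟩
  · rintro ⟨_, ⟨N, hq⟩, rfl⟩
    exact ⟨_, _, hq, rfl⟩

theorem rename_congr {f g : ℕ → ℕ} {M : Msg} (h : ∀ x ∈ M.fn, f x = g x) :
    M.rename f = M.rename g := by
  rw [Msg.rename_eq_app, Msg.rename_eq_app]
  exact Msg.app_congr (fun x hx => congrArg Msg.name (h x hx)) fun _ _ => rfl

/-- Up to a fresh choice of the bound name, a theory and its shift have the same
entailments. -/
theorem exists_unshift {Γ : Theory} (hΓ : Γ.fn.Finite) {F : Set ℕ} (hF : F.Finite) :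
    ∃ f g : ℕ → ℕ,
      (∀ M : Msg, M.fn ⊆ F → (M.rename g).rename f = M) ∧
      (∀ M N : Msg, Entails (Γ.shift 1) M N → Entails Γ (M.rename g) (N.rename g)) ∧
      (∀ M N : Msg, Entails Γ M N → Entails (Γ.shift 1) (M.rename f) (N.rename f)) ∧
      (∀ M : Msg, Synth (Γ.shift 1).pi1 M → Synth Γ.pi1 (M.rename g)) ∧
      ∀ M : Msg, Synth (Γ.shift 1).pi2 M → Synth Γ.pi2 (M.rename g) := by
  obtain ⟨m, hm⟩ := (hΓ.union hF).bddAbove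
  have hm1 : ∀ x ∈ Γ.fn, x ≤ m := fun x hx => hm (.inl hx)
  have hm2 : ∀ x ∈ F, x ≤ m := fun x hx => hm (.inr hx)
  -- All names of `Γ` and `F` are at most `m`, so `m + 1` is a free stand-in for the bound index
  -- `0`: `g` removes the shift and sends `0` to `m + 1`, and `f` undoes this on `F`.
  let f : ℕ → ℕ := fun x => if x = m + 1 then 0 else x + 1
  let g : ℕ → ℕ := fun x => if x = 0 then m + 1 else x - 1
  have hg : ∀ M : Msg, (M.rename (· + 1)).rename g = M := fun M => by
    rw [Msg.rename, Msg.subst_rename]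
    simpa [g] using M.subst_name
  refine ⟨f, g, fun M hM => ?_, fun M N h => ?_, fun M N h => ?_, fun M h => ?_, fun M h => ?_⟩
  · rw [Msg.rename, Msg.subst_rename]
    refine (rename_congr (g := _root_.id) fun x hx => ?_).trans M.subst_name
    have := hm2 x (hM hx)
    simp only [f, g, _root_.id]
    split_ifs <;> omega
  · refine h.subst (fun x => .var _) ?_
    rintro _ ⟨q, hq, rfl⟩
    change Entails Γ ((q.1.rename (· + 1)).rename g) ((q.2.rename (· + 1)).rename g)
    rw [hg, hg]
    exact .id hq
  · refine h.subst (fun x => .var _) fun q hq => .id ⟨q, hq, ?_⟩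
    refine Prod.ext (rename_congr fun x hx => ?_) (rename_congr fun x hx => ?_)
    · have := hm1 x ⟨q, hq, .inl hx⟩
      simp only [f]; split_ifs <;> omega
    · have := hm1 x ⟨q, hq, .inr hx⟩
      simp only [f]; split_ifs <;> omega
  · refine h.subst (fun x => .var _) ?_
    rw [pi1_shift]
    rintro _ ⟨M, hM, rfl⟩
    change Synth Γ.pi1 ((M.rename (· + 1)).rename g)
    rw [hg]
    exact .id hM
  · refine h.subst (fun x => .var _) ?_
    rw [pi2_shift]
    rintro _ ⟨M, hM, rfl⟩
    change Synth Γ.pi2 ((M.rename (· + 1)).rename g)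
    rw [hg]
    exact .id hM

/-- Every instance of a clause involves finitely many names, so `exists_unshift` transfers it to
`Γ`. For uniqueness the names of `R` have to be included. -/
theorem Consistent.shift {Γ : Theory} (h : Γ.Consistent) (hΓ : Γ.fn.Finite) :
    (Γ.shift 1).Consistent := by
  intro M N hMN
  have hfin := M.fn_finite.union N.fn_finite
  refine ⟨?_, ?_, fun R => ?_⟩
  · obtain ⟨f, g, _, hg, _⟩ := exists_unshift hΓ hfin
    have := (h _ _ (hg _ _ hMN)).1
    cases M <;> cases N <;> exact this
  · rintro M₁ M₂ N₁ N₂ rfl rfl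
    obtain ⟨f, g, hfg, hg, hf, hg1, hg2⟩ := exists_unshift hΓ hfin
    have := (h _ _ (hg _ _ hMN)).2.1 _ _ _ _ rfl rfl
    rw [← hfg M₂ fun x hx => .inl (.inr hx), ← hfg N₂ fun x hx => .inr (.inr hx)]
    refine ⟨fun hs => hf _ _ (this.1 (hg1 _ ?_)), fun hs => hf _ _ (this.2 (hg2 _ ?_))⟩
    · rwa [hfg M₂ fun x hx => .inl (.inr hx)] at hs
    · rwa [hfg N₂ fun x hx => .inr (.inr hx)] at hs
  · obtain ⟨f, g, hfg, hg, hf, _⟩ := exists_unshift hΓ (hfin.union R.fn_finite)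
    have := (h _ _ (hg _ _ hMN)).2.2 (R.rename g)
    refine ⟨fun hR => ?_, fun hR => ?_⟩
    · rw [← hfg R fun x hx => .inr hx, this.1 (hg _ _ hR), hfg N fun x hx => .inl (.inr hx)]
    · rw [← hfg R fun x hx => .inr hx, this.2 (hg _ _ hR), hfg M fun x hx => .inl (.inl hx)]

theorem Consistent.unique {Γ : Theory} (h : Γ.Consistent) {M N R : Msg} (h₁ : Entails Γ M N)
    (h₂ : Entails Γ M R) : R = N :=
  ((h _ _ h₁).2.2 R).1 h₂

/-- By cut, an entailed pair adds nothing to entailment, nor to synthesis from either projection. -/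
theorem Consistent.insert {Γ : Theory} (h : Γ.Consistent) {M N : Msg} (hMN : Entails Γ M N) :
    Theory.Consistent (insert (M, N) Γ) := by
  have cut : ∀ {A B}, Entails (Insert.insert (M, N) Γ) A B → Entails Γ A B := fun hAB =>
    hAB.cut <| by
      rintro p (rfl | hp)
      · exact hMN
      · exact .id hp
  have weak : ∀ {A B}, Entails Γ A B → Entails (Insert.insert (M, N) Γ) A B := fun hAB =>
    hAB.mono (Set.subset_insert _ _)
  intro A B hAB
  have := h A B (cut hAB)
  refine ⟨this.1, fun A₁ A₂ B₁ B₂ hA hB => ?_, fun R => ⟨fun hR => (this.2.2 R).1 (cut hR),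
    fun hR => (this.2.2 R).2 (cut hR)⟩⟩
  rw [pi1_insert, pi2_insert]
  refine ⟨fun hs => weak ((this.2.1 A₁ A₂ B₁ B₂ hA hB).1 (hs.cut ?_)),
    fun hs => weak ((this.2.1 A₁ A₂ B₁ B₂ hA hB).2 (hs.cut ?_))⟩
  · rintro X (rfl | hX)
    · exact hMN.synth.1
    · exact .id hX
  · rintro X (rfl | hX)
    · exact hMN.synth.2
    · exact .id hX

end Theory


/-! ## Bi-traces -/

namespace Trace

theorem theory_cons (e : IOPair) (h : Trace) :
    theory (e :: h) = insert (e.fst, e.snd) (theory h) := by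
  ext p; simp [theory]

theorem theory_subset_cons (e : IOPair) (h : Trace) : theory h ⊆ theory (e :: h) := by
  rw [theory_cons]; exact Set.subset_insert _ _

theorem mem_fn_cons {e : IOPair} {h : Trace} {x : ℕ} :
    x ∈ fn (e :: h) ↔ x ∈ e.fst.fn ∪ e.snd.fn ∨ x ∈ fn h := by
  simp [fn]

theorem subst_cons (θ₁ θ₂ : ℕ → Msg) (e : IOPair) (h : Trace) :
    subst θ₁ θ₂ (e :: h) = ⟨e.mark, e.fst.subst θ₁, e.snd.subst θ₂⟩ :: subst θ₁ θ₂ h := rfl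

theorem fn_theory (h : Trace) : h.theory.fn = h.fn := by
  ext x
  constructor
  · rintro ⟨_, ⟨e, he, rfl⟩, hx⟩
    exact ⟨e, he, hx⟩
  · rintro ⟨e, he, hx⟩
    exact ⟨_, ⟨e, he, rfl⟩, hx⟩

theorem fn_finite (h : Trace) : h.fn.Finite := by
  induction h with
  | nil => simp [fn]
  | cons e h ih =>
    refine ((e.fst.fn_finite.union e.snd.fn_finite).union ih).subset fun x hx => ?_
    exact mem_fn_cons.1 hx

theorem rn_theory (h : Trace) : ∀ p ∈ h.theory, p.1.rn ∪ p.2.rn ⊆ h.rn := by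
  rintro _ ⟨e, he, rfl⟩ a ha
  exact ⟨e, he, ha⟩

theorem subst_name (h : Trace) : subst Msg.name Msg.name h = h := by
  simp [subst, Msg.subst_name]

end Trace

theorem Msg.subst_subst (σ τ : ℕ → Msg) (M : Msg) :
    (M.subst σ).subst τ = M.subst fun x => (σ x).subst τ := by
  simp only [subst_eq_app, app_app]; rfl

theorem Trace.subst_subst (θ₁ θ₂ η₁ η₂ : ℕ → Msg) (h : Trace) :
    (h.subst θ₁ θ₂).subst η₁ η₂ =
      h.subst (fun x => (θ₁ x).subst η₁) (fun x => (θ₂ x).subst η₂) := by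
  simp [subst, Msg.subst_subst]

theorem respects_cons {θ₁ θ₂ : ℕ → Msg} {m : Mark} {M N : Msg} {h : Trace} :
    Respects θ₁ θ₂ (⟨m, M, N⟩ :: h) ↔ Respects θ₁ θ₂ h ∧
      (m = Mark.i → ∀ x ∈ M.fn ∪ N.fn, Entails (h.subst θ₁ θ₂).theory (θ₁ x) (θ₂ x)) := by
  constructor
  · intro H
    refine ⟨fun h₁ h₂ A B e => H h₁ (⟨m, M, N⟩ :: h₂) A B (by rw [e]; rfl), ?_⟩
    rintro rfl
    exact H h [] M N rfl
  · rintro ⟨H₁, H₂⟩ h₁ h₂ A B e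
    rcases h₂ with _ | ⟨p, h₂⟩
    · cases e
      exact H₂ rfl
    · cases e
      exact H₁ h₁ h₂ A B rfl

theorem respects_name (h : Trace) : Respects Msg.name Msg.name h :=
  fun _ _ _ _ _ _ _ => .var _

namespace Trace

theorem consistent_cons_i {M N : Msg} {h : Trace} :
    Consistent (⟨Mark.i, M, N⟩ :: h) ↔ Consistent h ∧ Entails h.theory M N := by
  rw [Consistent]

theorem consistent_cons_o {M N : Msg} {h : Trace} :
    Consistent (⟨Mark.o, M, N⟩ :: h) ↔ Consistent h ∧ M.fn ∪ N.fn ⊆ fn h ∧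
      ∀ θ₁ θ₂ : ℕ → Msg, FiniteDom θ₁ → FiniteDom θ₂ → Respects θ₁ θ₂ h →
        Consistent (subst θ₁ θ₂ h) →
        (theory (subst θ₁ θ₂ (⟨Mark.o, M, N⟩ :: h))).Consistent := by
  rw [Consistent]

theorem Consistent.tail {e : IOPair} {h : Trace} (H : Consistent (e :: h)) : Consistent h := by
  obtain ⟨_ | _, M, N⟩ := e
  · exact (consistent_cons_i.1 H).1
  · exact (consistent_cons_o.1 H).1

/-- The names of a consistent bi-trace occur in both of its projections. -/
theorem Consistent.mem_fn {h : Trace} (H : h.Consistent) {x : ℕ} (hx : x ∈ h.fn) :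
    (∃ e ∈ h, x ∈ e.fst.fn) ∧ ∃ e ∈ h, x ∈ e.snd.fn := by
  induction h with
  | nil => simp [fn] at hx
  | cons e h ih =>
    by_cases hxh : x ∈ fn h
    · obtain ⟨⟨e₁, he₁, hx₁⟩, e₂, he₂, hx₂⟩ := ih H.tail hxh
      exact ⟨⟨e₁, .tail _ he₁, hx₁⟩, e₂, .tail _ he₂, hx₂⟩
    · have hxe := (mem_fn_cons.1 hx).resolve_right hxh
      obtain ⟨_ | _, M, N⟩ := e
      · have := (consistent_cons_i.1 H).2.mem_fn_iff (x := x) (by rwa [fn_theory])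
        have hMN : x ∈ M.fn ∧ x ∈ N.fn := by
          rcases hxe with hM | hN
          · exact ⟨hM, this.1 hM⟩
          · exact ⟨this.2 hN, hN⟩
        exact ⟨⟨_, .head _, hMN.1⟩, _, .head _, hMN.2⟩
      · exact (hxh ((consistent_cons_o.1 H).2.1 hxe)).elim

/-- Since `x` occurs in both projections, a name of either image of `x` surfaces in the substituted
trace. -/
theorem Consistent.mem_fn_subst {h : Trace} (H : h.Consistent) {x y : ℕ} (hx : x ∈ h.fn)
    {θ₁ θ₂ : ℕ → Msg} (hy : y ∈ (θ₁ x).fn ∪ (θ₂ x).fn) : y ∈ (h.subst θ₁ θ₂).fn := by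
  obtain ⟨⟨e₁, he₁, hx₁⟩, e₂, he₂, hx₂⟩ := H.mem_fn hx
  rcases hy with hy | hy
  · exact ⟨_, List.mem_map_of_mem he₁, .inl (Msg.mem_fn_subst.2 ⟨x, hx₁, hy⟩)⟩
  · exact ⟨_, List.mem_map_of_mem he₂, .inr (Msg.mem_fn_subst.2 ⟨x, hx₂, hy⟩)⟩

/-- A respectful pair of substitutions maps the names of a consistent bi-trace to entailed
pairs. -/
theorem Consistent.entails_of_mem_fn {h : Trace} (H : h.Consistent) {θ₁ θ₂ : ℕ → Msg}
    (hθ : Respects θ₁ θ₂ h) {x : ℕ} (hx : x ∈ h.fn) :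
    Entails (h.subst θ₁ θ₂).theory (θ₁ x) (θ₂ x) := by
  induction h with
  | nil => simp [fn] at hx
  | cons e h ih =>
    obtain ⟨m, M, N⟩ := e
    obtain ⟨hθ₁, hθ₂⟩ := respects_cons.1 hθ
    rw [subst_cons]
    refine Entails.mono ?_ (theory_subset_cons _ _)
    rcases mem_fn_cons.1 hx with hx | hx
    · cases m with
      | i => exact hθ₂ rfl x hx
      | o => exact ih H.tail hθ₁ ((consistent_cons_o.1 H).2.1 hx)
    · exact ih H.tail hθ₁ hx

/-- The point on which stability of consistency rests: testing an output of `hθ` against `η` becomes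
testing the output of `h` against the composite. -/
theorem Consistent.respects_comp {h : Trace} (H : h.Consistent) {θ₁ θ₂ η₁ η₂ : ℕ → Msg}
    (Hθ : (h.subst θ₁ θ₂).Consistent) (hθ : Respects θ₁ θ₂ h)
    (hη : Respects η₁ η₂ (h.subst θ₁ θ₂)) :
    Respects (fun x => (θ₁ x).subst η₁) (fun x => (θ₂ x).subst η₂) h := by
  induction h with
  | nil => intro h₁ h₂ M N e; simp at e
  | cons e h ih =>
    obtain ⟨m, M, N⟩ := e
    rw [subst_cons] at Hθ hη
    rw [respects_cons] at hθ hη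
    refine respects_cons.2 ⟨ih H.tail Hθ.tail hθ.1 hη.1, ?_⟩
    rintro rfl x hx
    rw [← subst_subst]
    refine (hθ.2 rfl x hx).subst_of_mem (fun y hy => ?_) ?_
    · by_cases hyh : y ∈ fn (Trace.subst θ₁ θ₂ h)
      · exact Hθ.tail.entails_of_mem_fn hη.1 hyh
      -- If `y` is new to the substituted trace, then `x` is new to `h`, hence occurs in both `M`
      -- and `N`. So `y` occurs in the substituted input pair, to which respectfulness of `η`
      -- applies.
      · rw [fn_theory] at hy
        have hy := hy.resolve_left hyh
        have hxh : x ∉ fn h := fun hxh => hyh (H.tail.mem_fn_subst hxh hy)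
        have := (consistent_cons_i.1 H).2.mem_fn_iff (x := x) (by rwa [fn_theory])
        have hMN : x ∈ M.fn ∧ x ∈ N.fn := by
          rcases hx with hM | hN
          · exact ⟨hM, this.1 hM⟩
          · exact ⟨this.2 hN, hN⟩
        exact hη.2 rfl y (hy.imp (fun hy => Msg.mem_fn_subst.2 ⟨x, hMN.1, hy⟩)
          fun hy => Msg.mem_fn_subst.2 ⟨x, hMN.2, hy⟩)
    · rintro _ ⟨e, he, rfl⟩
      exact .id ⟨_, List.mem_map_of_mem he, rfl⟩

theorem _root_.Spi.FiniteDom.comp {θ η : ℕ → Msg} (hθ : FiniteDom θ) (hη : FiniteDom η) :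
    FiniteDom fun x => (θ x).subst η := by
  refine (hθ.union hη).subset fun x hx => ?_
  by_contra hc
  simp only [Set.mem_union, Set.mem_ofPred_eq, not_or, not_not] at hc hx
  exact hx (by rw [hc.1]; exact hc.2)

theorem _root_.Spi.FiniteDom.name : FiniteDom Msg.name := by simp [FiniteDom]

/-- Consistency is preserved by respectful pairs of substitutions. -/
theorem Consistent.subst {h : Trace} (H : h.Consistent) {θ₁ θ₂ : ℕ → Msg}
    (hf₁ : FiniteDom θ₁) (hf₂ : FiniteDom θ₂) (hθ : Respects θ₁ θ₂ h) :
    (h.subst θ₁ θ₂).Consistent := by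
  induction h with
  | nil => exact H
  | cons e h ih =>
    obtain ⟨m, M, N⟩ := e
    have hθ' := respects_cons.1 hθ
    have Hθ := ih H.tail hθ'.1
    rw [subst_cons]
    cases m with
    | i =>
      refine consistent_cons_i.2 ⟨Hθ, (consistent_cons_i.1 H).2.subst_of_mem ?_ ?_⟩
      · rintro x (hx | hx)
        · rw [fn_theory] at hx
          exact H.tail.entails_of_mem_fn hθ'.1 hx
        · exact hθ'.2 rfl x hx
      · rintro _ ⟨e, he, rfl⟩
        exact .id ⟨_, List.mem_map_of_mem he, rfl⟩
    | o =>
      obtain ⟨_, hfn, hc⟩ := consistent_cons_o.1 H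
      refine consistent_cons_o.2 ⟨Hθ, ?_, ?_⟩
      · rintro y (hy | hy)
        · obtain ⟨x, hx, hy⟩ := Msg.mem_fn_subst.1 hy
          exact H.tail.mem_fn_subst (hfn (.inl hx)) (.inl hy)
        · obtain ⟨x, hx, hy⟩ := Msg.mem_fn_subst.1 hy
          exact H.tail.mem_fn_subst (hfn (.inr hx)) (.inr hy)
      · intro η₁ η₂ hg₁ hg₂ hη Hη
        have := hc _ _ (hf₁.comp hg₁) (hf₂.comp hg₂) (H.tail.respects_comp Hθ hθ'.1 hη)
          (by rwa [← subst_subst])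
        rwa [← subst_subst] at this

/-- The theory of a consistent bi-trace is consistent. -/
theorem Consistent.theory_consistent {h : Trace} (H : h.Consistent) : h.theory.Consistent := by
  induction h with
  | nil =>
    -- Over the empty theory entailment is equality, and whatever is synthesized is entailed with
    -- itself.
    have hE : ∀ (Γ : Theory) (M N : Msg), Entails Γ M N → Γ = ∅ → M = N := by
      intro Γ M N h hΓ
      induction h with
      | var => rfl
      | id h => simp [hΓ] at h
      | pr _ _ ih₁ ih₂ => rw [ih₁ hΓ, ih₂ hΓ]
      | er _ _ ih₁ ih₂ => rw [ih₁ hΓ, ih₂ hΓ]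
      | pl h => simp [hΓ] at h
      | el h => simp [hΓ] at h
    have hS : ∀ (S : Set Msg) (M : Msg), Synth S M → S = ∅ → Entails ∅ M M := by
      intro S M h hS
      induction h with
      | var => exact .var _
      | id h => simp [hS] at h
      | pr _ _ ih₁ ih₂ => exact .pr (ih₁ hS) (ih₂ hS)
      | er _ _ ih₁ ih₂ => exact .er (ih₁ hS) (ih₂ hS)
      | pl h => simp [hS] at h
      | el h => simp [hS] at h
    have h0 : theory [] = ∅ := by ext; simp [theory]
    have h1 : Theory.pi1 ∅ = ∅ := by ext; simp [Theory.pi1]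
    have h2 : Theory.pi2 ∅ = ∅ := by ext; simp [Theory.pi2]
    rw [h0]
    intro M N h
    obtain rfl := hE _ _ _ h rfl
    refine ⟨by cases M <;> trivial, ?_, fun R => ⟨fun hR => (hE _ _ _ hR rfl).symm,
      fun hR => hE _ _ _ hR rfl⟩⟩
    rintro M₁ M₂ N₁ N₂ rfl e
    cases e
    rw [h1, h2]
    exact ⟨fun h => hS _ _ h rfl, fun h => hS _ _ h rfl⟩
  | cons e h ih =>
    obtain ⟨_ | _, M, N⟩ := e
    · rw [theory_cons]
      exact (ih H.tail).insert (consistent_cons_i.1 H).2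
    -- The identity pair respects every trace, so the output clause includes the unsubstituted
    -- theory.
    · have := (consistent_cons_o.1 H).2.2 Msg.name Msg.name .name .name (respects_name h)
        (by rw [subst_name]; exact H.tail)
      rwa [subst_name] at this

end Trace

/-! ## Related processes -/

/-- Processes of the same shape, whose messages are entailed by `Γ`. -/
inductive Proc.Rel : Theory → Proc → Proc → Prop
  | nil {Γ} : Rel Γ nil nil
  | out {Γ M N P M' N' P'} : Entails Γ M M' → Entails Γ N N' → Rel Γ P P' →
      Rel Γ (out M N P) (out M' N' P')
  | inp {Γ M P M' P'} : Entails Γ M M' → Rel (Γ.shift 1) P P' → Rel Γ (inp M P) (inp M' P')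
  | par {Γ P Q P' Q'} : Rel Γ P P' → Rel Γ Q Q' → Rel Γ (par P Q) (par P' Q')
  | res {Γ P P'} : Rel (Γ.shift 1) P P' → Rel Γ (res P) (res P')
  | rep {Γ P P'} : Rel Γ P P' → Rel Γ (rep P) (rep P')
  | mat {Γ M N P M' N' P'} : Entails Γ M M' → Entails Γ N N' → Rel Γ P P' →
      Rel Γ (mat M N P) (mat M' N' P')
  | letp {Γ L P L' P'} : Entails Γ L L' → Rel (Γ.shift 2) P P' → Rel Γ (letp L P) (letp L' P')
  | dec {Γ L N P L' N' P'} : Entails Γ L L' → Entails Γ N N' → Rel (Γ.shift 1) P P' →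
      Rel Γ (dec L N P) (dec L' N' P')

/-- Actions whose messages are entailed by `Γ`. -/
inductive Action.Rel (Γ : Theory) : Action → Action → Prop
  | tau : Rel Γ tau tau
  | inp {M N} : Entails Γ M N → Rel Γ (inp M) (inp N)
  | out {M N} : Entails Γ M N → Rel Γ (out M) (out N)

/-- Agents of the same shape, whose messages are entailed by `Γ`. -/
inductive Agent.Rel (Γ : Theory) : Agent → Agent → Prop
  | proc {P Q} : Proc.Rel Γ P Q → Rel Γ (proc P) (proc Q)
  | abs {P Q} : Proc.Rel (Γ.shift 1) P Q → Rel Γ (abs P) (abs Q)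
  | conc {k M N P Q} : Entails (Γ.shift k) M N → Proc.Rel (Γ.shift k) P Q →
      Rel Γ (conc k M P) (conc k N Q)

/-- Weakening, shifting, instantiating and opening are all instances. Both hypotheses pass under a
binder because the bound name is entailed with itself. -/
theorem Proc.Rel.subst {Γ Δ : Theory} {P Q : Proc} {σ τ : ℕ → Msg} (h : Rel Γ P Q)
    (hn : ∀ x, Entails Δ (σ x) (τ x))
    (hΓ : ∀ p ∈ Γ, Entails Δ (p.1.subst σ) (p.2.subst τ)) :
    Rel Δ (P.subst σ) (Q.subst τ) := by
  have up_n : ∀ {Δ : Theory} {σ τ : ℕ → Msg}, (∀ x, Entails Δ (σ x) (τ x)) →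
      ∀ x, Entails (Δ.shift 1) (up σ x) (up τ x) := by
    rintro Δ σ τ hn (_ | x)
    · exact .var 0
    · exact (hn x).shift 1
  have up_t : ∀ {Γ Δ : Theory} {σ τ : ℕ → Msg},
      (∀ p ∈ Γ, Entails Δ (p.1.subst σ) (p.2.subst τ)) →
      ∀ p ∈ Γ.shift 1, Entails (Δ.shift 1) (p.1.subst (up σ)) (p.2.subst (up τ)) := by
    rintro Γ Δ σ τ hΓ _ ⟨q, hq, rfl⟩
    have h : ∀ (σ : ℕ → Msg) (M : Msg),
        (M.rename (· + 1)).subst (up σ) = (M.subst σ).rename (· + 1) := by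
      intro σ M
      rw [Msg.subst_rename, Msg.rename, Msg.subst_subst]; rfl
    rw [h, h]
    exact (hΓ q hq).shift 1
  induction h generalizing Δ σ τ with
  | nil => exact nil
  | out hM hN _ ih => exact out (hM.subst hn hΓ) (hN.subst hn hΓ) (ih hn hΓ)
  | inp hM _ ih => exact inp (hM.subst hn hΓ) (ih (up_n hn) (up_t hΓ))
  | par _ _ ih₁ ih₂ => exact par (ih₁ hn hΓ) (ih₂ hn hΓ)
  | res _ ih => exact res (ih (up_n hn) (up_t hΓ))
  | rep _ ih => exact rep (ih hn hΓ)
  | mat hM hN _ ih => exact mat (hM.subst hn hΓ) (hN.subst hn hΓ) (ih hn hΓ)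
  | letp hM _ ih =>
    refine letp (hM.subst hn hΓ) ?_
    rw [← Theory.shift_shift 1 1] at ih ⊢
    exact ih (up_n (up_n hn)) (up_t (up_t hΓ))
  | dec hM hN _ ih =>
    exact dec (hM.subst hn hΓ) (hN.subst hn hΓ) (ih (up_n hn) (up_t hΓ))

theorem Proc.Rel.mono {Γ Δ : Theory} {P Q : Proc} (h : Rel Γ P Q) (hΔ : Γ ⊆ Δ) : Rel Δ P Q := by
  have := h.subst (Δ := Δ) (σ := Msg.name) (τ := Msg.name) (fun x => .var x) fun p hp => by
    simpa only [Msg.subst_name] using Entails.id (hΔ hp)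
  simpa only [subst_name] using this

theorem Proc.Rel.shift {Γ : Theory} {P Q : Proc} (h : Rel Γ P Q) (k : ℕ) :
    Rel (Γ.shift k) (P.rename (· + k)) (Q.rename (· + k)) :=
  h.subst (fun _ => .var _) fun p hp => .id ⟨p, hp, rfl⟩

theorem Theory.rn_shift {Γ : Theory} {T : Set ℕ} (hT : ∀ p ∈ Γ, p.1.rn ∪ p.2.rn ⊆ T) (k : ℕ) :
    ∀ p ∈ Γ.shift k, p.1.rn ∪ p.2.rn ⊆ T := by
  rintro _ ⟨q, hq, rfl⟩
  simpa only [Msg.rn_rename] using hT q hq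

theorem Proc.Rel.rn_subset {Γ : Theory} {P Q : Proc} {T : Set ℕ} (h : Rel Γ P Q)
    (hT : ∀ p ∈ Γ, p.1.rn ∪ p.2.rn ⊆ T) : P.rn ∪ Q.rn ⊆ T := by
  have hM : ∀ {Γ : Theory} {M N : Msg}, (∀ p ∈ Γ, p.1.rn ∪ p.2.rn ⊆ T) → Entails Γ M N →
      M.rn ⊆ T ∧ N.rn ⊆ T := fun hT h => Set.union_subset_iff.1 (h.rn_subset hT)
  rw [Set.union_subset_iff]
  induction h with
  | nil => simp [rn]
  | out h₁ h₂ _ ih =>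
    have := hM hT h₁; have := hM hT h₂; have := ih hT
    simp only [rn, Set.union_subset_iff]; tauto
  | inp h₁ _ ih =>
    have := hM hT h₁; have := ih (Theory.rn_shift hT _)
    simp only [rn, Set.union_subset_iff]; tauto
  | par _ _ ih₁ ih₂ =>
    have := ih₁ hT; have := ih₂ hT
    simp only [rn, Set.union_subset_iff]; tauto
  | res _ ih => exact ih (Theory.rn_shift hT _)
  | rep _ ih => exact ih hT
  | mat h₁ h₂ _ ih =>
    have := hM hT h₁; have := hM hT h₂; have := ih hT
    simp only [rn, Set.union_subset_iff]; tauto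
  | letp h₁ _ ih =>
    have := hM hT h₁; have := ih (Theory.rn_shift hT _)
    simp only [rn, Set.union_subset_iff]; tauto
  | dec h₁ h₂ _ ih =>
    have := hM hT h₁; have := hM hT h₂; have := ih (Theory.rn_shift hT _)
    simp only [rn, Set.union_subset_iff]; tauto

theorem Proc.Rel.refl_of_pure {Γ : Theory} {P : Proc} (h : P.Pure) : Rel Γ P P := by
  induction P generalizing Γ with
  | nil => exact nil
  | out M N P ih =>
    simp only [Pure, rn, Set.union_empty_iff] at h
    exact out (.refl_of_pure h.1.1) (.refl_of_pure h.1.2) (ih h.2)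
  | inp M P ih =>
    simp only [Pure, rn, Set.union_empty_iff] at h
    exact inp (.refl_of_pure h.1) (ih h.2)
  | par P Q ihP ihQ =>
    simp only [Pure, rn, Set.union_empty_iff] at h
    exact par (ihP h.1) (ihQ h.2)
  | res P ih => exact res (ih h)
  | rep P ih => exact rep (ih h)
  | mat M N P ih =>
    simp only [Pure, rn, Set.union_empty_iff] at h
    exact mat (.refl_of_pure h.1.1) (.refl_of_pure h.1.2) (ih h.2)
  | letp L P ih =>
    simp only [Pure, rn, Set.union_empty_iff] at h
    exact letp (.refl_of_pure h.1) (ih h.2)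
  | dec L N P ih =>
    simp only [Pure, rn, Set.union_empty_iff] at h
    exact dec (.refl_of_pure h.1.1) (.refl_of_pure h.1.2) (ih h.2)

theorem Proc.Rel.resN {Γ : Theory} {P Q : Proc} {k : ℕ} (h : Rel (Γ.shift k) P Q) :
    Rel Γ (Proc.resN k P) (Proc.resN k Q) := by
  induction k generalizing Γ with
  | zero => simpa only [Theory.shift_zero, Proc.resN] using h
  | succ k ih =>
    refine res (ih ?_)
    rwa [Theory.shift_shift, add_comm]

/-- Instantiation of a bound name by messages that live under `k` binders. -/
theorem Proc.Rel.subst_instUnder {Γ : Theory} {P Q : Proc} {k : ℕ} {M N : Msg}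
    (h : Rel (Γ.shift 1) P Q) (hMN : Entails (Γ.shift k) M N) :
    Rel (Γ.shift k) (P.subst (instUnder k M)) (Q.subst (instUnder k N)) := by
  refine h.subst ?_ ?_
  · rintro (_ | x)
    · exact hMN
    · exact .var _
  · rintro _ ⟨q, hq, rfl⟩
    refine .id ⟨q, hq, ?_⟩
    rw [Msg.subst_rename, Msg.subst_rename]; rfl

/-- Each test uses its own part of consistency: uniqueness for matching, equality of types for
splitting, and all three clauses for decryption. -/
theorem Proc.Rel.red {Γ : Theory} (hΓ : Γ.Consistent) {P P' Q : Proc} (h : Rel Γ P P')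
    (hr : Red P Q) : ∃ Q', Red P' Q' ∧ Rel Γ Q Q' := by
  cases hr with
  | rep P => cases h with | rep h => exact ⟨_, .rep _, .par h (.rep h)⟩
  | mat M P =>
    cases h with
    | mat h₁ h₂ h =>
      obtain rfl := hΓ.unique h₁ h₂
      exact ⟨_, .mat _ _, h⟩
  | letp M N P =>
    cases h with
    | @letp _ _ _ L' P' hL h =>
      have hs := (hΓ _ _ hL).1
      cases L' with
      | pair M' N' =>
        refine ⟨_, .letp _ _ _, h.subst ?_ ?_⟩
        · rintro (_ | _ | x)
          · exact hL.pair_inv.2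
          · exact hL.pair_inv.1
          · exact .var _
        · rintro _ ⟨q, hq, rfl⟩
          rw [Msg.subst_rename, Msg.subst_rename]
          simpa only [inst2, Msg.subst_name] using Entails.id hq
      | _ => exact hs.elim
  | dec M N P =>
    cases h with
    | @dec _ _ _ _ L' N' P' hL hN h =>
      have hs := hΓ _ _ hL
      cases L' with
      | enc M' K =>
        -- Here `N` is the key of the left ciphertext and is synthesized, so the key clause entails
        -- it with the right key `K`; uniqueness identifies `K` with `N'`, and the right decryption
        -- succeeds.
        have hK := (hs.2.1 _ _ _ _ rfl rfl).1 hN.synth.1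
        obtain rfl := hΓ.unique hK hN
        refine ⟨_, .dec _ _ _, h.subst ?_ ?_⟩
        · rintro (_ | x)
          · exact hL.enc_inv hN
          · exact .var _
        · rintro _ ⟨q, hq, rfl⟩
          rw [Msg.subst_rename, Msg.subst_rename]
          simpa only [inst, Msg.subst_name] using Entails.id hq
      | _ => exact hs.1.elim

theorem Agent.Rel.parRight {Γ : Theory} {A B : Agent} {P Q : Proc} (h : Rel Γ A B)
    (hP : Proc.Rel Γ P Q) : Rel Γ (A.parRight P) (B.parRight Q) := by
  cases h with
  | proc h => exact .proc (.par h hP)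
  | abs h => exact .abs (.par h (hP.shift 1))
  | conc hM h => exact .conc hM (.par h (hP.shift _))

theorem Agent.Rel.parLeft {Γ : Theory} {A B : Agent} {P Q : Proc} (h : Rel Γ A B)
    (hP : Proc.Rel Γ P Q) : Rel Γ (A.parLeft P) (B.parLeft Q) := by
  cases h with
  | proc h => exact .proc (.par hP h)
  | abs h => exact .abs (.par (hP.shift 1) h)
  | conc hM h => exact .conc hM (.par (hP.shift _) h)

/-- The restricted name is foreign to the shifted theory, so it occurs in both messages or in
neither. Extrusion thus happens on both sides at once and the numbers of binders stay equal. -/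
theorem Agent.Rel.res {Γ : Theory} {A B : Agent} (h : Rel (Γ.shift 1) A B) :
    Rel Γ A.res B.res := by
  have hshift : ∀ {m n : ℕ} {f : ℕ → ℕ}, (∀ x, f (x + m) = x + n) → ∀ p ∈ Γ.shift m,
      Entails (Γ.shift n) (p.1.subst fun x => .name (f x)) (p.2.subst fun x => .name (f x)) := by
    rintro m n f hf _ ⟨q, hq, rfl⟩
    refine .id ⟨q, hq, ?_⟩
    rw [Msg.subst_rename, Msg.subst_rename]
    simp only [hf]; rfl
  cases h with
  | proc h => exact .proc (.res h)
  | abs h =>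
    refine .abs (.res ?_)
    rw [Theory.shift_shift] at h ⊢
    refine h.subst (fun _ => .var _) (hshift fun x => ?_)
    simp
  | @conc k M N P Q hM h =>
    rw [Theory.shift_shift] at hM h
    have hk := hM.mem_fn_iff (Theory.not_mem_fn_shift (show k < 1 + k by omega) Γ)
    by_cases hkM : k ∈ M.fn
    · rw [res_conc_of_mem _ hkM, res_conc_of_mem _ (hk.1 hkM)]
      rw [add_comm] at hM h
      exact .conc hM h
    · rw [res_conc_of_not_mem _ hkM, res_conc_of_not_mem _ fun e => hkM (hk.2 e)]
      refine .conc (hM.subst (fun _ => .var _) (hshift fun x => ?_)) (.res ?_)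
      · split_ifs <;> omega
      · rw [Theory.shift_shift]
        refine h.subst (fun _ => .var _) (hshift fun x => ?_)
        split_ifs <;> omega

theorem Msg.exists_rename_succ {M : Msg} (h : 0 ∉ M.fn) :
    ∃ N : Msg, M = N.rename (· + 1) := by
  refine ⟨M.rename (· - 1), ?_⟩
  rw [rename, rename, subst_subst]
  refine (subst_name M).symm.trans ?_
  rw [subst_eq_app, subst_eq_app]
  refine app_congr (fun x hx => ?_) fun _ _ => rfl
  have : x ≠ 0 := fun e => h (e ▸ hx)
  simp only [Sub.ofNames, subst, Msg.name.injEq]; omega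

/-- Lets a matching action cross a restriction: by `mem_fn_iff` the partner of a message avoiding
the restricted name avoids it too. -/
theorem Entails.unshift {Γ : Theory} {M N : Msg} (h : Entails (Γ.shift 1) (M.rename (· + 1)) N) :
    ∃ N', N = N'.rename (· + 1) ∧ Entails Γ M N' := by
  have h0 : 0 ∉ N.fn := by
    rw [← h.mem_fn_iff (Theory.not_mem_fn_shift Nat.one_pos Γ), Msg.mem_fn_rename]
    rintro ⟨y, _, hy⟩; omega
  obtain ⟨N', rfl⟩ := Msg.exists_rename_succ h0
  refine ⟨N', rfl, ?_⟩
  -- The value of the truncated subtraction at `0` is harmless, since every name is entailed with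
  -- itself.
  have := h.subst (Δ := Γ) (σ := fun x => .name (x - 1)) (τ := fun x => .name (x - 1))
    (fun _ => .var _) (by
      rintro _ ⟨q, hq, rfl⟩
      rw [Msg.subst_rename, Msg.subst_rename]
      simpa only [Nat.add_sub_cancel, Msg.subst_name] using Entails.id hq)
  rw [Msg.subst_rename, Msg.subst_rename] at this
  simpa only [Nat.add_sub_cancel, Msg.subst_name] using this

/-- Related processes have related transitions if the theory is consistent. -/
theorem Proc.Rel.step {Γ : Theory} (hΓ : Γ.Consistent) (hfin : Γ.fn.Finite) {P P' : Proc}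
    {α : Action} {A : Agent} (h : Rel Γ P P') (hs : Step P α A) :
    ∃ α' A', Step P' α' A' ∧ Action.Rel Γ α α' ∧ Agent.Rel Γ A A' := by
  induction hs generalizing Γ P' with
  | inp M P => cases h with | inp hM h => exact ⟨_, _, .inp _ _, .inp hM, .abs h⟩
  | out M N P =>
    cases h with
    | out hM hN h =>
      refine ⟨_, _, .out _ _ _, .out hM, .conc ?_ ?_⟩
      · rwa [Theory.shift_zero]
      · rwa [Theory.shift_zero]
  | commFC _ _ ih₁ ih₂ =>
    cases h with
    | par h₁ h₂ =>
      obtain ⟨_, _, hs₁, ⟨⟩ | hM₁ | _, _ | hA₁ | _⟩ := ih₁ hΓ hfin h₁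
      obtain ⟨_, _, hs₂, ⟨⟩ | _ | hM₂, _ | _ | ⟨hN, hA₂⟩⟩ := ih₂ hΓ hfin h₂
      -- The two answers to the common channel coincide, so the answering processes can communicate
      -- as well.
      obtain rfl := hΓ.unique hM₁ hM₂
      exact ⟨_, _, .commFC hs₁ hs₂, .tau, .proc (.resN (.par (hA₁.subst_instUnder hN) hA₂))⟩
  | commCF _ _ ih₁ ih₂ =>
    cases h with
    | par h₁ h₂ =>
      obtain ⟨_, _, hs₁, ⟨⟩ | _ | hM₁, _ | _ | ⟨hN, hA₁⟩⟩ := ih₁ hΓ hfin h₁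
      obtain ⟨_, _, hs₂, ⟨⟩ | hM₂ | _, _ | hA₂ | _⟩ := ih₂ hΓ hfin h₂
      obtain rfl := hΓ.unique hM₁ hM₂
      exact ⟨_, _, .commCF hs₁ hs₂, .tau, .proc (.resN (.par hA₁ (hA₂.subst_instUnder hN)))⟩
  | red hr _ ih =>
    obtain ⟨Q', hr', hQ⟩ := h.red hΓ hr
    obtain ⟨α', A', hs', hα, hA⟩ := ih hΓ hfin hQ
    exact ⟨α', A', .red hr' hs', hα, hA⟩
  | parL _ ih =>
    cases h with
    | par h₁ h₂ =>
      obtain ⟨α', A', hs', hα, hA⟩ := ih hΓ hfin h₁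
      exact ⟨α', _, .parL hs', hα, hA.parRight h₂⟩
  | parR _ ih =>
    cases h with
    | par h₁ h₂ =>
      obtain ⟨α', A', hs', hα, hA⟩ := ih hΓ hfin h₂
      exact ⟨α', _, .parR hs', hα, hA.parLeft h₁⟩
  | @res P α A _ ih =>
    cases h with
    | res h =>
      obtain ⟨α', A', hs', hα, hA⟩ := ih (hΓ.shift hfin) (Theory.fn_shift_finite hfin 1) h
      cases α with
      | tau => cases hα; exact ⟨.tau, _, .res hs', .tau, hA.res⟩
      | inp M =>
        cases hα with
        | inp hM =>
          obtain ⟨N, rfl, hN⟩ := hM.unshift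
          exact ⟨.inp N, _, .res hs', .inp hN, hA.res⟩
      | out M =>
        cases hα with
        | out hM =>
          obtain ⟨N, rfl, hN⟩ := hM.unshift
          exact ⟨.out N, _, .res hs', .out hN, hA.res⟩


/-! ## Injective renamings of all names to names -/

/-- The substitution that renames names by `f` and replaces rigid names by names according to
`r`. -/
def Sub.atoms (f r : ℕ → ℕ) : Sub := ⟨fun x => Msg.name (f x), fun a => Msg.name (r a)⟩

theorem Sub.lift_nm_eq_name {s : Sub} {k x : ℕ} (h : k ≤ x → s.nm (x - k) = Msg.name (x - k)) :
    (s.lift k).nm x = Msg.name x := by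
  rcases lt_or_ge x k with hk | hk
  · exact lift_nm_lt _ hk
  · rw [lift_nm_ge _ hk, h hk]
    simp only [Msg.rename, Msg.subst, Nat.sub_add_cancel hk]

theorem Sub.lift_rg_eq_rigid {s : Sub} {a : ℕ} (k : ℕ) (h : s.rg a = Msg.rigid a) :
    (s.lift k).rg a = Msg.rigid a := by
  rw [lift_rg, h]; rfl

theorem Agent.app_eq_self {s : Sub} {A : Agent} (h₁ : ∀ x ∈ A.fn, s.nm x = Msg.name x)
    (h₂ : ∀ a ∈ A.rn, s.rg a = Msg.rigid a) : A.app s = A := by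
  cases A with
  | proc P => exact congrArg proc (Proc.app_eq_self h₁ h₂)
  | abs P =>
    refine congrArg abs (Proc.app_eq_self (fun x hx => Sub.lift_nm_eq_name fun hk => h₁ _ ?_)
      fun a ha => Sub.lift_rg_eq_rigid _ (h₂ a ha))
    simpa only [fn, Set.mem_ofPred_eq, Nat.sub_add_cancel hk] using hx
  | conc k M P =>
    refine congrArg₂ (conc k)
      (Msg.app_eq_self (fun x hx => Sub.lift_nm_eq_name fun hk => h₁ _ ?_)
        fun a ha => Sub.lift_rg_eq_rigid _ (h₂ a (.inl ha)))
      (Proc.app_eq_self (fun x hx => Sub.lift_nm_eq_name fun hk => h₁ _ ?_)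
        fun a ha => Sub.lift_rg_eq_rigid _ (h₂ a (.inr ha)))
    · simpa only [fn, Set.mem_ofPred_eq, Nat.sub_add_cancel hk] using Set.mem_union_left _ hx
    · simpa only [fn, Set.mem_ofPred_eq, Nat.sub_add_cancel hk] using Set.mem_union_right _ hx

theorem Agent.app_app (s t : Sub) (A : Agent) : (A.app s).app t = A.app (s.comp t) := by
  cases A <;> simp [app, Msg.app_app, Proc.app_app, Sub.lift_comp]

theorem Action.app_app (s t : Sub) (α : Action) : (α.app s).app t = α.app (s.comp t) := by
  cases α <;> simp [app, Msg.app_app]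

theorem Action.app_congr {s t : Sub} {α : Action} (h₁ : ∀ x ∈ α.fn, s.nm x = t.nm x)
    (h₂ : ∀ a ∈ α.rn, s.rg a = t.rg a) : α.app s = α.app t := by
  cases α with
  | tau => rfl
  | inp M => exact congrArg inp (Msg.app_congr h₁ h₂)
  | out M => exact congrArg out (Msg.app_congr h₁ h₂)

theorem Action.app_eq_self {s : Sub} {α : Action} (h₁ : ∀ x ∈ α.fn, s.nm x = Msg.name x)
    (h₂ : ∀ a ∈ α.rn, s.rg a = Msg.rigid a) : α.app s = α := by
  cases α with
  | tau => rfl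
  | inp M => exact congrArg inp (Msg.app_eq_self h₁ h₂)
  | out M => exact congrArg out (Msg.app_eq_self h₁ h₂)

/-- The inverse returns a name in the image to the name or rigid name it came from. Outside the
image its values are arbitrary, so the round trip is claimed only there. -/
theorem Sub.atoms_leftInverse {f r : ℕ → ℕ} (h : Function.Injective (Sum.elim f r)) :
    ∃ t : Sub, (Sub.atoms f r).comp t = ⟨Msg.name, Msg.rigid⟩ ∧
      (∀ x, (t.comp (Sub.atoms f r)).nm (f x) = Msg.name (f x)) ∧
      ∀ a, (t.comp (Sub.atoms f r)).nm (r a) = Msg.name (r a) := by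
  have hl : ∀ x, Function.invFun (Sum.elim f r) (f x) = .inl x := fun x =>
    Function.leftInverse_invFun h (.inl x)
  have hr : ∀ a, Function.invFun (Sum.elim f r) (r a) = .inr a := fun a =>
    Function.leftInverse_invFun h (.inr a)
  refine ⟨⟨fun n => (Function.invFun (Sum.elim f r) n).elim Msg.name Msg.rigid, Msg.rigid⟩,
    ?_, ?_, ?_⟩
  · ext x <;> simp [comp, atoms, Msg.app, hl, hr]
  · intro x; simp [comp, atoms, Msg.app, hl]
  · intro x; simp [comp, atoms, Msg.app, hr]

theorem Action.app_atoms_injective {f r : ℕ → ℕ} (h : Function.Injective (Sum.elim f r)) :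
    Function.Injective (Action.app (Sub.atoms f r)) := by
  obtain ⟨t, ht, -⟩ := Sub.atoms_leftInverse h
  refine Function.LeftInverse.injective (g := Action.app t) fun α => ?_
  rw [app_app, ht]
  exact app_eq_self (fun _ _ => rfl) fun _ _ => rfl

/-- Injective renamings reflect transitions. -/
theorem Step.of_app_atoms {f r : ℕ → ℕ} (h : Function.Injective (Sum.elim f r)) {P : Proc}
    {β : Action} {B : Agent} (hs : Step (P.app (Sub.atoms f r)) β B) :
    ∃ α A, Step P α A ∧ β = α.app (Sub.atoms f r) ∧ B = A.app (Sub.atoms f r) := by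
  obtain ⟨t, ht, hf, hr⟩ := Sub.atoms_leftInverse h
  -- The left inverse preserves the transition. As no names are created, all names of `β` and `B`
  -- lie in the image, so applying the renaming again recovers both.
  have hs' := hs.app t
  rw [Proc.app_app, ht, Proc.app_eq_self (fun _ _ => rfl) (fun _ _ => rfl)] at hs'
  obtain ⟨⟨h₁, h₂⟩, h₃, h₄⟩ := hs.fn_rn
  have hfn : ∀ x ∈ (P.app (Sub.atoms f r)).fn,
      (t.comp (Sub.atoms f r)).nm x = Msg.name x := by
    intro x hx
    rcases Proc.mem_fn_app.1 hx with ⟨y, _, hx⟩ | ⟨a, _, hx⟩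
    · cases hx; exact hf y
    · cases hx; exact hr a
  have hrn : ∀ a ∈ (P.app (Sub.atoms f r)).rn,
      (t.comp (Sub.atoms f r)).rg a = Msg.rigid a := by
    intro a ha
    rcases Proc.mem_rn_app.1 ha with ⟨y, _, hx⟩ | ⟨a, _, hx⟩ <;> cases hx
  refine ⟨_, _, hs', ?_, ?_⟩
  · rw [Action.app_app]
    exact (Action.app_eq_self (fun x hx => hfn x (h₁ hx)) fun a ha => hrn a (h₂ ha)).symm
  · rw [Agent.app_app]
    exact (Agent.app_eq_self (fun x hx => hfn x (h₃ hx)) fun a ha => hrn a (h₄ ha)).symm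

/-! ## Transitions of restricted processes -/

theorem Action.shift_app_add (α : Action) (k : ℕ) :
    α.shift.app (Sub.ofNames fun x => .name (x + k)) =
      α.app (Sub.ofNames fun x => .name (x + (k + 1))) := by
  cases α <;> simp [shift, app, Msg.app_rename, Sub.ofNames, add_assoc, add_comm 1 k]

/-- No reduction starts from a restriction, so only the rule `res` applies, `k` times. `Step.resN`
is the converse. -/
theorem step_resN {k : ℕ} {P : Proc} {α : Action} {A : Agent} (h : Step (Proc.resN k P) α A) :
    ∃ B, Step P (α.app (Sub.ofNames fun x => .name (x + k))) B := by
  induction k generalizing α A with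
  | zero =>
    rw [Action.app_eq_self (fun _ _ => rfl) (fun _ _ => rfl)]
    exact ⟨A, h⟩
  | succ k ih =>
    cases h with
    | red hr => cases hr
    | res h =>
      rw [← Action.shift_app_add]
      exact ih h

theorem Step.resN {k : ℕ} {P : Proc} {α : Action} {B : Agent}
    (h : Step P (α.app (Sub.ofNames fun x => .name (x + k))) B) :
    ∃ A, Step (Proc.resN k P) α A := by
  induction k generalizing α with
  | zero =>
    rw [Action.app_eq_self (fun _ _ => rfl) (fun _ _ => rfl)] at h
    exact ⟨B, h⟩
  | succ k ih =>
    rw [← Action.shift_app_add] at h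
    obtain ⟨A, hA⟩ := ih h
    exact ⟨_, .res hA⟩

/-- `Agent.res` preserves the kind of an agent, so a silent step leaves the `k` restrictions in
place. -/
theorem tauStep_resN {k : ℕ} {P P' : Proc} (h : TauStep (Proc.resN k P) P') :
    ∃ Q, TauStep P Q ∧ P' = Proc.resN k Q := by
  induction k generalizing P' with
  | zero => exact ⟨P', h, rfl⟩
  | succ k ih =>
    generalize hA : Agent.proc P' = A at h
    have h : Step (Proc.resN (k + 1) P) .tau A := hA ▸ h
    cases h with
    | red hr => cases hr
    | @res _ _ A h =>
      cases A with
      | proc R =>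
        obtain ⟨Q, hQ, rfl⟩ := ih h
        cases hA
        exact ⟨Q, hQ, rfl⟩
      | abs R => cases hA
      | conc j M R =>
        simp only [Agent.res] at hA
        split_ifs at hA

theorem TauStep.resN {P Q : Proc} (h : TauStep P Q) (k : ℕ) :
    TauStep (Proc.resN k P) (Proc.resN k Q) := by
  induction k with
  | zero => exact h
  | succ k ih => exact Step.res (α := .tau) ih

theorem Step.shape {P : Proc} {α : Action} {A : Agent} (h : Step P α A) :
    (∀ M, α = .inp M → ∃ P', A = .abs P') ∧ ∀ M, α = .out M → ∃ k N P', A = .conc k N P' := by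
  induction h with
  | inp M P => exact ⟨fun _ _ => ⟨_, rfl⟩, by simp⟩
  | out M N P => exact ⟨by simp, fun _ _ => ⟨_, _, _, rfl⟩⟩
  | commFC => simp
  | commCF => simp
  | red _ _ ih => exact ih
  | parL _ ih =>
    refine ⟨fun M e => ?_, fun M e => ?_⟩
    · obtain ⟨P', rfl⟩ := ih.1 M e; exact ⟨_, rfl⟩
    · obtain ⟨k, N, P', rfl⟩ := ih.2 M e; exact ⟨_, _, _, rfl⟩
  | parR _ ih =>
    refine ⟨fun M e => ?_, fun M e => ?_⟩
    · obtain ⟨P', rfl⟩ := ih.1 M e; exact ⟨_, rfl⟩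
    · obtain ⟨k, N, P', rfl⟩ := ih.2 M e; exact ⟨_, _, _, rfl⟩
  | res _ ih =>
    refine ⟨fun M e => ?_, fun M e => ?_⟩
    · subst e
      obtain ⟨P', rfl⟩ := ih.1 _ rfl; exact ⟨_, rfl⟩
    · subst e
      obtain ⟨k, N, P', rfl⟩ := ih.2 _ rfl
      simp only [Agent.res]
      split_ifs <;> exact ⟨_, _, _, rfl⟩

/-! ## Opening binders -/

/-- Opens `j` binders by the names `m, …, m + j - 1`. -/
def openName (m j x : ℕ) : ℕ := if x < j then m + x else x - j

/-- The renaming `f`, seen from under `j` binders that were opened by the names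
`m, …, m + j - 1`. -/
def extendName (m j : ℕ) (f : ℕ → ℕ) (x : ℕ) : ℕ := if m ≤ x ∧ x < m + j then x - m else f x + j

/-- The values below `j` are reserved for the opened names; all others are shifted past `j`. -/
theorem extendName_injective (m j : ℕ) {f r : ℕ → ℕ} (h : Function.Injective (Sum.elim f r)) :
    Function.Injective (Sum.elim (extendName m j f) fun a => r a + j) := by
  rintro (x | a) (y | b) e
  · simp only [Sum.elim_inl, extendName] at e
    split_ifs at e with h₁ h₂ h₂
    · rw [show x = y by omega]
    · omega
    · omega
    · exact h (by simpa using e)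
  · simp only [Sum.elim_inl, Sum.elim_inr, extendName] at e
    split_ifs at e with h₁
    · omega
    · exact h (by simpa using e)
  · simp only [Sum.elim_inl, Sum.elim_inr, extendName] at e
    split_ifs at e with h₁
    · omega
    · exact h (by simpa using e)
  · exact h (by simpa using e)

/-- Renaming under `j` binders is opening them by names unused in the body, followed by the extended
renaming. This turns an extrusion by the observer into `j` further restrictions of a configuration.
-/
theorem Proc.app_lift_atoms_openName {m j : ℕ} (f r : ℕ → ℕ) {P : Proc}
    (h : ∀ x, x + j ∈ P.fn → x < m) :
    P.app ((Sub.atoms f r).lift j) =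
      (P.rename (openName m j)).app (Sub.atoms (extendName m j f) fun a => r a + j) := by
  rw [rename_eq_app, app_app]
  refine app_congr (fun x hx => ?_) fun _ _ => rfl
  rcases lt_or_ge x j with hj | hj
  · rw [Sub.lift_nm_lt _ hj]
    simp [Sub.comp, Sub.ofNames, Sub.atoms, Msg.app, openName, extendName, hj]
  · have := h (x - j) (by rwa [Nat.sub_add_cancel hj])
    rw [Sub.lift_nm_ge _ hj]
    simp [Sub.comp, Sub.ofNames, Sub.atoms, Msg.app, openName, extendName, not_lt.2 hj,
      not_le.2 this, Msg.rename, Msg.subst]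

open Classical in
/-- The renaming `r` of rigid names, seen from under `j` binders that were opened by the rigid
names `c`. -/
noncomputable def extendRigid {j : ℕ} (c : Fin j → ℕ) (r : ℕ → ℕ) (a : ℕ) : ℕ :=
  if h : ∃ i, c i = a then h.choose else r a + j

theorem extendRigid_apply {j : ℕ} {c : Fin j → ℕ} (hc : Function.Injective c) (r : ℕ → ℕ)
    (i : Fin j) : extendRigid c r (c i) = i := by
  have h : ∃ i', c i' = c i := ⟨i, rfl⟩
  rw [extendRigid, dif_pos h, hc h.choose_spec]

theorem extendRigid_of_notMem {j : ℕ} {c : Fin j → ℕ} {r : ℕ → ℕ} {a : ℕ}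
    (h : a ∉ Set.range c) : extendRigid c r a = r a + j :=
  dif_neg h

/-- The old values of `r` on `c` are overwritten by indices below `j`; all other values are shifted
past them. -/
theorem extendRigid_injective {j : ℕ} {c : Fin j → ℕ} (hc : Function.Injective c) {f r : ℕ → ℕ}
    (h : Function.Injective (Sum.elim f r)) :
    Function.Injective (Sum.elim (fun x => f x + j) (extendRigid c r)) := by
  have hr : ∀ a, (∃ i : Fin j, a = c i ∧ extendRigid c r a = i) ∨
      extendRigid c r a = r a + j := by
    intro a
    by_cases ha : a ∈ Set.range c
    · obtain ⟨i, rfl⟩ := ha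
      exact .inl ⟨i, rfl, extendRigid_apply hc r i⟩
    · exact .inr (extendRigid_of_notMem ha)
  rintro (x | a) (y | b) e
  · exact h (by simpa using e)
  · simp only [Sum.elim_inl, Sum.elim_inr] at e
    rcases hr b with ⟨i, rfl, hi⟩ | hb
    · have := i.2; omega
    · exact h (by simp only [Sum.elim_inl, Sum.elim_inr]; omega)
  · simp only [Sum.elim_inl, Sum.elim_inr] at e
    rcases hr a with ⟨i, rfl, hi⟩ | ha
    · have := i.2; omega
    · exact h (by simp only [Sum.elim_inl, Sum.elim_inr]; omega)
  · simp only [Sum.elim_inr] at e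
    rcases hr a with ⟨i, rfl, hi⟩ | ha <;> rcases hr b with ⟨i', rfl, hi'⟩ | hb
    · rw [show i = i' from Fin.ext (by omega)]
    · have := i.2; omega
    · have := i'.2; omega
    · exact h (by simp only [Sum.elim_inr]; omega)

/-- The analogue for names extruded by the process, opened by rigid names. Their freshness makes the
overwriting in `extendRigid` invisible to the body. -/
theorem Proc.app_lift_atoms_instRigid {j : ℕ} {c : Fin j → ℕ} (hc : Function.Injective c)
    (f r : ℕ → ℕ) {P : Proc} (h : ∀ a ∈ P.rn, a ∉ Set.range c) :
    P.app ((Sub.atoms f r).lift j) =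
      (P.subst (instRigid c)).app (Sub.atoms (fun x => f x + j) (extendRigid c r)) := by
  rw [subst_eq_app, app_app]
  refine app_congr (fun x hx => ?_) fun a ha => ?_
  · rcases lt_or_ge x j with hj | hj
    · rw [Sub.lift_nm_lt _ hj]
      simp [Sub.comp, Sub.ofNames, Sub.atoms, Msg.app, instRigid, hj, extendRigid_apply hc]
    · rw [Sub.lift_nm_ge _ hj]
      simp [Sub.comp, Sub.ofNames, Sub.atoms, Msg.app, instRigid, not_lt.2 hj, Msg.rename,
        Msg.subst]
  · simp [Sub.lift_rg, Sub.comp, Sub.ofNames, Sub.atoms, Msg.app, Msg.rename, Msg.subst,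
      extendRigid_of_notMem (h a ha)]


/-! ## Soundness -/

theorem Proc.fn_finite (P : Proc) : P.fn.Finite := by
  have h : ∀ {A : Set ℕ} (k : ℕ), A.Finite → {x | x + k ∈ A}.Finite := fun k hA =>
    hA.preimage fun x _ y _ e => Nat.add_right_cancel e
  induction P with
  | nil => exact Set.finite_empty
  | out M N P ih => exact (M.fn_finite.union N.fn_finite).union ih
  | inp M P ih => exact M.fn_finite.union (h 1 ih)
  | par P Q ihP ihQ => exact ihP.union ihQ
  | res P ih => exact h 1 ih
  | rep P ih => exact ih
  | mat M N P ih => exact (M.fn_finite.union N.fn_finite).union ih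
  | letp L P ih => exact L.fn_finite.union (h 2 ih)
  | dec L N P ih => exact (L.fn_finite.union N.fn_finite).union (h 1 ih)

theorem Action.fn_finite (α : Action) : α.fn.Finite := by
  cases α with
  | tau => exact Set.finite_empty
  | inp M => exact M.fn_finite
  | out M => exact M.fn_finite

theorem Proc.subst_subst (σ τ : ℕ → Msg) (P : Proc) :
    (P.subst σ).subst τ = P.subst fun x => (σ x).subst τ := by
  simp only [subst_eq_app, app_app, Msg.subst_eq_app]; rfl

theorem Proc.subst_congr {σ τ : ℕ → Msg} {P : Proc} (h : ∀ x ∈ P.fn, σ x = τ x) :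
    P.subst σ = P.subst τ := by
  rw [subst_eq_app, subst_eq_app]
  exact app_congr h fun _ _ => rfl

theorem Msg.subst_eq_self {σ : ℕ → Msg} {M : Msg} (h : ∀ x ∈ M.fn, σ x = name x) :
    M.subst σ = M := by
  rw [subst_eq_app]
  exact app_eq_self h fun _ _ => rfl

theorem Trace.subst_eq_self {σ τ : ℕ → Msg} {h : Trace}
    (H : ∀ x ∈ h.fn, σ x = Msg.name x ∧ τ x = Msg.name x) : h.subst σ τ = h := by
  refine (List.map_congr_left fun e he => ?_).trans (List.map_id h)
  rw [Msg.subst_eq_self fun x hx => (H x ⟨e, he, .inl hx⟩).1,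
    Msg.subst_eq_self fun x hx => (H x ⟨e, he, .inr hx⟩).2]
  rfl

theorem Proc.Rel.subst_inst {Γ Δ : Theory} {P Q : Proc} {M N : Msg} (h : Rel (Γ.shift 1) P Q)
    (hΓ : Γ ⊆ Δ) (hMN : Entails Δ M N) : Rel Δ (P.subst (inst M)) (Q.subst (inst N)) := by
  refine h.subst ?_ ?_
  · rintro (_ | x)
    · exact hMN
    · exact .var _
  · rintro _ ⟨q, hq, rfl⟩
    rw [Msg.subst_rename, Msg.subst_rename]
    simpa only [inst, Msg.subst_name] using Entails.id (hΓ hq)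

theorem Entails.openName {Γ : Theory} {M N : Msg} (m : ℕ) {j : ℕ}
    (h : Entails (Γ.shift j) M N) :
    Entails Γ (M.rename (openName m j)) (N.rename (openName m j)) := by
  refine h.subst (fun _ => .var _) ?_
  rintro _ ⟨q, hq, rfl⟩
  rw [Msg.subst_rename, Msg.subst_rename]
  simpa [Spi.openName, Msg.subst_name] using Entails.id hq

theorem Proc.Rel.openName {Γ : Theory} {P Q : Proc} (m : ℕ) {j : ℕ} (h : Rel (Γ.shift j) P Q) :
    Rel Γ (P.rename (openName m j)) (Q.rename (openName m j)) := by
  refine h.subst (fun _ => .var _) ?_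
  rintro _ ⟨q, hq, rfl⟩
  rw [Msg.subst_rename, Msg.subst_rename]
  simpa [Spi.openName, Msg.subst_name] using Entails.id hq

/-- Instantiation of `0` by a message whose `j` binders are then opened factors through the
instantiation by a fresh name. -/
theorem Proc.rename_openName_subst_instUnder {m j : ℕ} (M : Msg) {P : Proc}
    (h : ∀ x, x + 1 ∈ P.fn → x < m) :
    (P.subst (instUnder j M)).rename (openName m j) =
      (P.subst (inst (.name m))).subst
        (fun x => if x = m then M.rename (openName m j) else .name x) := by
  rw [rename, subst_subst, subst_subst]
  refine subst_congr fun x hx => ?_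
  rcases x with _ | x
  · simp [instUnder, inst, Msg.subst, Msg.rename]
  · have := h x hx
    simp [instUnder, inst, Msg.subst, openName, this.ne]

theorem Proc.subst_instUnder_instRigid {j : ℕ} (c : Fin j → ℕ) (M : Msg) (P : Proc) :
    (P.subst (instUnder j M)).subst (instRigid c) = P.subst (inst (M.subst (instRigid c))) := by
  rw [subst_subst]
  refine subst_congr fun x _ => ?_
  rcases x with _ | x
  · rfl
  · simp [instUnder, inst, Msg.subst, instRigid]

/-- The pairs of processes obtained from a traced pair of a bisimulation and related observers
in parallel, where the private names are restricted. The names in `B` are public. -/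
inductive Config (𝓡 : Trace → Proc → Proc → Prop) (B : Set ℕ) : Proc → Proc → Prop
  | mk {h : Trace} {P Q R₁ R₂ : Proc} {θ₁ θ₂ : ℕ → Msg} {f₁ r₁ f₂ r₂ : ℕ → ℕ} {k l : ℕ} :
      𝓡 h P Q → FiniteDom θ₁ → FiniteDom θ₂ → Respects θ₁ θ₂ h →
      Proc.Rel (h.subst θ₁ θ₂).theory R₁ R₂ →
      Function.Injective (Sum.elim f₁ r₁) → Function.Injective (Sum.elim f₂ r₂) →
      (∀ b ∈ B, f₁ b = b + k ∧ f₂ b = b + l) →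
      Config 𝓡 B (Proc.resN k (((P.subst θ₁).par R₁).app (Sub.atoms f₁ r₁)))
        (Proc.resN l (((Q.subst θ₂).par R₂).app (Sub.atoms f₂ r₂)))

/-! ### Lockstep simulation of runs -/

section

variable {𝓡 : Trace → Proc → Proc → Prop} {B : Set ℕ} {h : Trace} {P Q R₁ R₂ : Proc}
  {θ₁ θ₂ : ℕ → Msg} {f₁ r₁ f₂ r₂ : ℕ → ℕ} {k l : ℕ}

/-- For use after a move of the bisimulation, whose new trace has already absorbed the
substitutions. -/
theorem config_id (hPQ : 𝓡 h P Q) (hR : Proc.Rel h.theory R₁ R₂)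
    (hi₁ : Function.Injective (Sum.elim f₁ r₁)) (hi₂ : Function.Injective (Sum.elim f₂ r₂))
    (hB : ∀ b ∈ B, f₁ b = b + k ∧ f₂ b = b + l) :
    Config 𝓡 B (Proc.resN k ((P.par R₁).app (Sub.atoms f₁ r₁)))
      (Proc.resN l ((Q.par R₂).app (Sub.atoms f₂ r₂))) := by
  have := Config.mk (B := B) (θ₁ := Msg.name) (θ₂ := Msg.name) hPQ .name .name
    (respects_name h) (by rwa [Trace.subst_name]) hi₁ hi₂ hB
  rwa [Proc.subst_name, Proc.subst_name] at this

theorem IsOpenBisimulation.consistent_subst (H : IsOpenBisimulation 𝓡) (hPQ : 𝓡 h P Q)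
    (hf₁ : FiniteDom θ₁) (hf₂ : FiniteDom θ₂) (hθ : Respects θ₁ θ₂ h) :
    (h.subst θ₁ θ₂).theory.Consistent :=
  ((H.consistent _ _ _ hPQ).subst hf₁ hf₂ hθ).theory_consistent

theorem Trace.fn_theory_finite (h : Trace) : h.theory.fn.Finite := by
  rw [fn_theory]; exact h.fn_finite

/-- The process inputs a message from the observer. -/
theorem config_commFC (H : IsOpenBisimulation 𝓡) (hBf : B.Finite) (hPQ : 𝓡 h P Q)
    (hf₁ : FiniteDom θ₁) (hf₂ : FiniteDom θ₂) (hθ : Respects θ₁ θ₂ h)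
    (hR : Proc.Rel (h.subst θ₁ θ₂).theory R₁ R₂)
    (hi₁ : Function.Injective (Sum.elim f₁ r₁)) (hi₂ : Function.Injective (Sum.elim f₂ r₂))
    (hB : ∀ b ∈ B, f₁ b = b + k ∧ f₂ b = b + l) {M N : Msg} {j : ℕ} {P' R₁' : Proc}
    (hP : Step (P.subst θ₁) (.inp M) (.abs P')) (hR₁ : Step R₁ (.out M) (.conc j N R₁')) :
    ∃ Z, TauStep ((Q.subst θ₂).par R₂) Z ∧
      Config 𝓡 B (Proc.resN k ((interactFC P' j N R₁').app (Sub.atoms f₁ r₁)))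
        (Proc.resN l (Z.app (Sub.atoms f₂ r₂))) := by
  have hΓ := H.consistent_subst hPQ hf₁ hf₂ hθ
  obtain ⟨_, _, hR₂, ⟨⟩ | _ | hM, _ | _ | @⟨_, _, N₂, _, R₂', hN, hR'⟩⟩ :=
    hR.step hΓ (Trace.fn_theory_finite _) hR₁
  rename_i M₂
  -- The fresh name also exceeds `B`, so that `extendName` only shifts the public names.
  obtain ⟨m, hm⟩ := ((((((h.subst θ₁ θ₂).fn_finite.union (P.subst θ₁).fn_finite).union
    (Q.subst θ₂).fn_finite).union R₁.fn_finite).union R₂.fn_finite).union hBf).bddAbove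
  simp only [mem_upperBounds, Set.mem_union] at hm
  have hmh : ∀ x ∈ (h.subst θ₁ θ₂).fn, x < m + 1 := fun x hx =>
    Nat.lt_succ_of_le (hm x (by tauto))
  have hmP : ∀ x ∈ (P.subst θ₁).fn, x < m + 1 := fun x hx =>
    Nat.lt_succ_of_le (hm x (by tauto))
  have hmQ : ∀ x ∈ (Q.subst θ₂).fn, x < m + 1 := fun x hx =>
    Nat.lt_succ_of_le (hm x (by tauto))
  have hmR₁ : ∀ x ∈ R₁.fn, x < m + 1 := fun x hx => Nat.lt_succ_of_le (hm x (by tauto))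
  have hmR₂ : ∀ x ∈ R₂.fn, x < m + 1 := fun x hx => Nat.lt_succ_of_le (hm x (by tauto))
  have hmB : ∀ x ∈ B, x < m + 1 := fun x hx => Nat.lt_succ_of_le (hm x (by tauto))
  clear hm
  generalize m + 1 = m at hmh hmP hmQ hmR₁ hmR₂ hmB
  obtain ⟨M₂', Q', hQ, hPQ'⟩ := H.input _ _ _ hPQ θ₁ θ₂ hf₁ hf₂ hθ M P' m hP
    (fun hx => (hmh m hx).false) hM.synth.1
  -- Consistency of the new trace entails the pair of input channels, and the observers entail `M`
  -- with their own output channel; by uniqueness the answers meet.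
  obtain rfl := hΓ.unique (Trace.consistent_cons_i.1 (H.consistent _ _ _ hPQ').tail).2 hM
  refine ⟨_, .commFC hQ hR₂, ?_⟩
  have hfP := hP.fn_rn
  have hfQ := hQ.fn_rn
  have hfR₁ := hR₁.fn_rn
  have hfR₂ := hR₂.fn_rn
  have hnm : ∀ {x : ℕ} (K : Msg), x < m → (if x = m then K else .name x) = Msg.name x :=
    fun K hx => if_neg hx.ne
  have hfin : ∀ K : Msg, FiniteDom fun x => if x = m then K else .name x := fun K =>
    (Set.finite_singleton m).subset fun x hx => by
      by_contra hc
      exact hx (if_neg hc)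
  set N' := N.rename (openName m j)
  set N₂' := N₂.rename (openName m j)
  have hNN : Entails (h.subst θ₁ θ₂).theory N' N₂' := hN.openName m
  -- The name `m` is both the input variable and, if `j > 0`, the first opened name. There is no
  -- clash: the occurrences of `m` in `N'` are not substituted again, and `σ₁` is not applied to the
  -- observer.
  set σ₁ : ℕ → Msg := fun x => if x = m then N' else .name x with hσ₁
  set σ₂ : ℕ → Msg := fun x => if x = m then N₂' else .name x with hσ₂
  have hself : (h.subst θ₁ θ₂).subst σ₁ σ₂ = h.subst θ₁ θ₂ :=
    Trace.subst_eq_self fun x hx => ⟨hnm _ (hmh x hx), hnm _ (hmh x hx)⟩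
  have hvar : ∀ {Γ : Theory} {x : ℕ}, x < m → Entails Γ (σ₁ x) (σ₂ x) := by
    intro Γ x hx
    rw [hσ₁, hσ₂]
    simp only [hnm _ hx]
    exact .var x
  have hresp : Respects σ₁ σ₂
      (⟨.i, .name m, .name m⟩ :: ⟨.i, M, M₂⟩ :: h.subst θ₁ θ₂) := by
    refine respects_cons.2 ⟨respects_cons.2 ⟨?_, ?_⟩, ?_⟩
    · intro h₁ h₂ A C e x hx
      refine hvar (hmh x ?_)
      rw [e]
      exact ⟨⟨.i, A, C⟩, by simp, hx⟩
    · rintro - x (hx | hx)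
      · exact hvar (hmP x (hfP.1.1 hx))
      · exact hvar (hmQ x (hfQ.1.1 hx))
    · rintro - x hx
      have hx : x = m := by simpa [Msg.fn] using hx
      subst hx
      simp only [hσ₁, hσ₂, if_true]
      rw [Trace.subst_cons, hself]
      exact hNN.mono (Trace.theory_subset_cons _ _)
  have hrel : Proc.Rel (Trace.subst σ₁ σ₂
      (⟨.i, .name m, .name m⟩ :: ⟨.i, M, M₂⟩ :: h.subst θ₁ θ₂)).theory
      (R₁'.rename (openName m j)) (R₂'.rename (openName m j)) := by
    rw [Trace.subst_cons, Trace.subst_cons, hself]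
    exact (hR'.openName m).mono
      ((Trace.theory_subset_cons _ _).trans (Trace.theory_subset_cons _ _))
  have key := Config.mk (B := B) (k := k + j) (l := l + j) hPQ' (hfin N') (hfin N₂') hresp hrel
    (extendName_injective m j hi₁) (extendName_injective m j hi₂) (fun b hb => by
      have := hB b hb
      have := hmB b hb
      simp only [extendName]
      constructor <;> split_ifs <;> omega)
  -- Read backwards, instantiating `m` by the opened message is the communication under the binders,
  -- and the opened names return to being restrictions.
  rw [← Proc.rename_openName_subst_instUnder, ← Proc.rename_openName_subst_instUnder] at key
  · have hpar : ∀ A C : Proc, (A.rename (openName m j)).par (C.rename (openName m j)) =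
      (A.par C).rename (openName m j) := fun _ _ => rfl
    rw [hpar, hpar, ← Proc.app_lift_atoms_openName, ← Proc.app_lift_atoms_openName,
      ← Proc.resN_resN, ← Proc.resN_resN, ← Proc.app_resN, ← Proc.app_resN] at key
    · exact key
    · rintro x (hx | hx)
      · rcases (Q'.fn_rn_subst_instUnder j N₂).1 x hx with hx | hx
        · exact hmQ x (hfQ.2.1 hx)
        · exact hmR₂ x (hfR₂.2.1 (.inl hx))
      · exact hmR₂ x (hfR₂.2.1 (.inr hx))
    · rintro x (hx | hx)
      · rcases (P'.fn_rn_subst_instUnder j N).1 x hx with hx | hx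
        · exact hmP x (hfP.2.1 hx)
        · exact hmR₁ x (hfR₁.2.1 (.inl hx))
      · exact hmR₁ x (hfR₁.2.1 (.inr hx))
  · exact fun x hx => hmQ x (hfQ.2.1 hx)
  · exact fun x hx => hmP x (hfP.2.1 hx)

/-- The process outputs a message to the observer. -/
theorem config_commCF (H : IsOpenBisimulation 𝓡) (hPQ : 𝓡 h P Q)
    (hf₁ : FiniteDom θ₁) (hf₂ : FiniteDom θ₂) (hθ : Respects θ₁ θ₂ h)
    (hR : Proc.Rel (h.subst θ₁ θ₂).theory R₁ R₂)
    (hi₁ : Function.Injective (Sum.elim f₁ r₁)) (hi₂ : Function.Injective (Sum.elim f₂ r₂))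
    (hB : ∀ b ∈ B, f₁ b = b + k ∧ f₂ b = b + l) {M N : Msg} {i : ℕ} {P' R₁' : Proc}
    (hP : Step (P.subst θ₁) (.out M) (.conc i N P')) (hR₁ : Step R₁ (.inp M) (.abs R₁')) :
    ∃ Z, TauStep ((Q.subst θ₂).par R₂) Z ∧
      Config 𝓡 B (Proc.resN k ((interactCF i N P' R₁').app (Sub.atoms f₁ r₁)))
        (Proc.resN l (Z.app (Sub.atoms f₂ r₂))) := by
  have hΓ := H.consistent_subst hPQ hf₁ hf₂ hθ
  obtain ⟨_, _, hR₂, ⟨⟩ | hM | _, _ | @⟨_, R₂', hR'⟩ | _⟩ :=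
    hR.step hΓ (Trace.fn_theory_finite _) hR₁
  obtain ⟨M₂', j, N₂, Q', hQ, c, d, hc, hd, hcd, hPQ'⟩ :=
    H.output _ _ _ hPQ θ₁ θ₂ hf₁ hf₂ hθ M i N P' hP hM.synth.1
  obtain rfl := hΓ.unique (Trace.consistent_cons_i.1 (H.consistent _ _ _ hPQ').tail).2 hM
  refine ⟨_, .commCF hQ hR₂, ?_⟩
  have hfP := hP.fn_rn
  have hfQ := hQ.fn_rn
  have hfR₁ := hR₁.fn_rn
  have hfR₂ := hR₂.fn_rn
  -- The rigid names of the observers come from the trace, so `c` and `d` are fresh for them too.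
  have hrR := hR.rn_subset (Trace.rn_theory _)
  have hfresh : ∀ a ∈ (h.subst θ₁ θ₂).rn ∪ (P.subst θ₁).rn ∪ (Q.subst θ₂).rn,
      a ∉ Set.range c ∧ a ∉ Set.range d := fun a ha =>
    ⟨fun hac => (Set.ext_iff.1 hcd a).1 ⟨.inl hac, ha⟩,
      fun had => (Set.ext_iff.1 hcd a).1 ⟨.inr had, ha⟩⟩
  -- The transmitted messages form the new output pair of the trace, hence may be instantiated in
  -- the related continuations of the observers.
  have key := config_id (B := B) (k := k + i) (l := l + j) hPQ'
    (hR'.subst_inst ((Trace.theory_subset_cons _ _).trans (Trace.theory_subset_cons _ _))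
      (.id ⟨_, .head _, rfl⟩))
    (extendRigid_injective hc hi₁) (extendRigid_injective hd hi₂) (fun b hb => by
      have := hB b hb
      constructor <;> omega)
  rw [← Proc.subst_instUnder_instRigid, ← Proc.subst_instUnder_instRigid] at key
  have hpar : ∀ (σ : ℕ → Msg) (A C : Proc),
    (A.subst σ).par (C.subst σ) = (A.par C).subst σ := fun _ _ _ => rfl
  rw [hpar, hpar, ← Proc.app_lift_atoms_instRigid hc, ← Proc.app_lift_atoms_instRigid hd,
    ← Proc.resN_resN, ← Proc.resN_resN, ← Proc.app_resN, ← Proc.app_resN] at key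
  · exact key
  · rintro a (ha | ha)
    · exact (hfresh a (.inr (hfQ.2.2 (.inr ha)))).2
    · rcases (R₂'.fn_rn_subst_instUnder j N₂).2 ha with ha | ha
      · exact (hfresh a (.inl (.inl (hrR (.inr (hfR₂.2.2 ha)))))).2
      · exact (hfresh a (.inr (hfQ.2.2 (.inl ha)))).2
  · rintro a (ha | ha)
    · exact (hfresh a (.inl (.inr (hfP.2.2 (.inr ha))))).1
    · rcases (R₁'.fn_rn_subst_instUnder i N).2 ha with ha | ha
      · exact (hfresh a (.inl (.inl (hrR (.inl (hfR₁.2.2 ha)))))).1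
      · exact (hfresh a (.inl (.inr (hfP.2.2 (.inl ha))))).1

theorem config_tau (H : IsOpenBisimulation 𝓡) (hBf : B.Finite) (hPQ : 𝓡 h P Q)
    (hf₁ : FiniteDom θ₁) (hf₂ : FiniteDom θ₂) (hθ : Respects θ₁ θ₂ h)
    (hR : Proc.Rel (h.subst θ₁ θ₂).theory R₁ R₂)
    (hi₁ : Function.Injective (Sum.elim f₁ r₁)) (hi₂ : Function.Injective (Sum.elim f₂ r₂))
    (hB : ∀ b ∈ B, f₁ b = b + k ∧ f₂ b = b + l) {X : Proc}
    (hX : TauStep ((P.subst θ₁).par R₁) X) :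
    ∃ Z, TauStep ((Q.subst θ₂).par R₂) Z ∧
      Config 𝓡 B (Proc.resN k (X.app (Sub.atoms f₁ r₁)))
        (Proc.resN l (Z.app (Sub.atoms f₂ r₂))) := by
  generalize hA : Agent.proc X = A at hX
  have hX : Step ((P.subst θ₁).par R₁) .tau A := hA ▸ hX
  cases hX with
  | commFC h₁ h₂ =>
    cases hA
    exact config_commFC H hBf hPQ hf₁ hf₂ hθ hR hi₁ hi₂ hB h₁ h₂
  | commCF h₁ h₂ =>
    cases hA
    exact config_commCF H hPQ hf₁ hf₂ hθ hR hi₁ hi₂ hB h₁ h₂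
  | red hr => cases hr
  | @parL _ _ _ A hs =>
    cases A with
    | proc P' =>
      cases hA
      obtain ⟨Q', hQ, hPQ'⟩ := H.tau _ _ _ hPQ θ₁ θ₂ hf₁ hf₂ hθ P' hs
      exact ⟨_, Step.parL hQ, config_id hPQ' hR hi₁ hi₂ hB⟩
    | _ => cases hA
  | @parR _ _ _ A hs =>
    cases A with
    | proc R' =>
      cases hA
      obtain ⟨_, _, hR₂, ⟨⟩, ⟨hR'⟩⟩ := hR.step (H.consistent_subst hPQ hf₁ hf₂ hθ)
        (Trace.fn_theory_finite _) hs
      exact ⟨_, Step.parR hR₂, .mk hPQ hf₁ hf₂ hθ hR' hi₁ hi₂ hB⟩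
    | _ => cases hA

/-- A pure channel is entailed with itself, so uniqueness leaves no other channel for the answer. -/
theorem barb_of_rel (H : IsOpenBisimulation 𝓡) (hPQ : 𝓡 h P Q)
    (hf₁ : FiniteDom θ₁) (hf₂ : FiniteDom θ₂) (hθ : Respects θ₁ θ₂ h)
    (hR : Proc.Rel (h.subst θ₁ θ₂).theory R₁ R₂) {β : Action} (hβ : IsBarb β) {A : Agent}
    (hs : Step ((P.subst θ₁).par R₁) β A) : ∃ A', Step ((Q.subst θ₂).par R₂) β A' := by
  have hΓ := H.consistent_subst hPQ hf₁ hf₂ hθ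
  obtain ⟨M, hM, hβ⟩ := hβ
  have hMM : Entails (h.subst θ₁ θ₂).theory M M := .refl_of_pure hM
  cases hs with
  | commFC => simp at hβ
  | commCF => simp at hβ
  | red hr => cases hr
  | parL hs =>
    rcases hβ with rfl | rfl
    · obtain ⟨P', rfl⟩ := hs.shape.1 M rfl
      obtain ⟨x, hx⟩ := (h.subst θ₁ θ₂).fn_finite.exists_notMem
      obtain ⟨M', Q', hQ, hPQ'⟩ := H.input _ _ _ hPQ θ₁ θ₂ hf₁ hf₂ hθ M P' x hs hx hMM.synth.1
      obtain rfl := hΓ.unique hMM (Trace.consistent_cons_i.1 (H.consistent _ _ _ hPQ').tail).2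
      exact ⟨_, .parL hQ⟩
    · obtain ⟨i, N, P', rfl⟩ := hs.shape.2 M rfl
      obtain ⟨M', j, N', Q', hQ, c, d, hc, hd, hcd, hPQ'⟩ :=
        H.output _ _ _ hPQ θ₁ θ₂ hf₁ hf₂ hθ M i N P' hs hMM.synth.1
      obtain rfl := hΓ.unique hMM (Trace.consistent_cons_i.1 (H.consistent _ _ _ hPQ').tail).2
      exact ⟨_, .parL hQ⟩
  | parR hs =>
    obtain ⟨β', A', hs', hβ', -⟩ := hR.step hΓ (Trace.fn_theory_finite _) hs
    have : β' = β := by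
      rcases hβ with rfl | rfl
      · cases hβ' with
        | inp h' => rw [hΓ.unique hMM h']
      · cases hβ' with
        | out h' => rw [hΓ.unique hMM h']
    exact ⟨_, .parR (this ▸ hs')⟩

/-- Restrictions and renaming are stripped on the left, where reflection needs injectivity, and put
back on the right, where preservation suffices. -/
theorem Config.tauStep (H : IsOpenBisimulation 𝓡) (hBf : B.Finite) {X Y X' : Proc}
    (hXY : Config 𝓡 B X Y) (hX : TauStep X X') : ∃ Y', TauStep Y Y' ∧ Config 𝓡 B X' Y' := by
  obtain ⟨hPQ, hf₁, hf₂, hθ, hR, hi₁, hi₂, hB⟩ := hXY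
  obtain ⟨Z, hZ, rfl⟩ := tauStep_resN hX
  obtain ⟨α, A, hs, hα, hA⟩ := Step.of_app_atoms hi₁ hZ
  cases α with
  | tau =>
    cases A with
    | proc Z' =>
      cases hA
      obtain ⟨Y', hY, hc⟩ := config_tau H hBf hPQ hf₁ hf₂ hθ hR hi₁ hi₂ hB hs
      exact ⟨_, TauStep.resN (Step.app hY _) _, hc⟩
    | _ => cases hA
  | _ => cases hα

/-- On a barb, which has no rigid names, the renaming is just the weakening past `k` restrictions,
so the barb stays visible unchanged. -/
theorem Action.app_atoms_eq_of_pure {f r : ℕ → ℕ} {k : ℕ} {β : Action} (hβ : IsBarb β)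
    (hf : ∀ b ∈ β.fn, f b = b + k) :
    β.app (Sub.ofNames fun x => .name (x + k)) = β.app (Sub.atoms f r) := by
  have hrn : β.rn = ∅ := by
    obtain ⟨M, hM, rfl | rfl⟩ := hβ
    · exact hM
    · exact hM
  refine app_congr (fun x hx => ?_) fun a ha => ?_
  · simp [Sub.ofNames, Sub.atoms, hf x hx]
  · simp [hrn] at ha

theorem Config.barb (H : IsOpenBisimulation 𝓡) {β : Action} (hβ : IsBarb β) {X Y : Proc}
    (hXY : Config 𝓡 β.fn X Y) {A : Agent} (hX : Step X β A) : ∃ A', Step Y β A' := by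
  obtain @⟨_, _, _, _, _, _, _, _, _, f₂, r₂, _, _, hPQ, hf₁, hf₂, hθ, hR, hi₁, hi₂, hB⟩ := hXY
  obtain ⟨A', hA'⟩ := step_resN hX
  obtain ⟨α, A'', hs, hα, -⟩ := Step.of_app_atoms hi₁ hA'
  rw [Action.app_atoms_eq_of_pure hβ fun b hb => (hB b hb).1] at hα
  obtain rfl := Action.app_atoms_injective hi₁ hα
  obtain ⟨A₂, hA₂⟩ := barb_of_rel H hPQ hf₁ hf₂ hθ hR hβ hs
  refine Step.resN (B := A₂.app (Sub.atoms f₂ r₂)) ?_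
  rw [Action.app_atoms_eq_of_pure hβ fun b hb => (hB b hb).2]
  exact hA₂.app (Sub.atoms f₂ r₂)

theorem Config.exhibits (H : IsOpenBisimulation 𝓡) {β : Action} (hβ : IsBarb β) {X Y : Proc}
    (hXY : Config 𝓡 β.fn X Y) (hX : Exhibits X β) : Exhibits Y β := by
  obtain ⟨X', A, hτ, hA⟩ := hX
  induction hτ using Relation.ReflTransGen.head_induction_on generalizing Y with
  | refl =>
    obtain ⟨A', hA'⟩ := hXY.barb H hβ hA
    exact ⟨Y, A', .refl, hA'⟩
  | head hs _ ih =>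
    obtain ⟨Y₁, hY₁, hc⟩ := hXY.tauStep H β.fn_finite hs
    obtain ⟨Y', A', hτ', hA'⟩ := ih hc
    exact ⟨Y', A', .head hY₁ hτ', hA'⟩

end

/-- There is an injection of all names into the names that fixes a given finite set. -/
theorem exists_injective_fixing {F : Set ℕ} (hF : F.Finite) :
    ∃ f r : ℕ → ℕ, Function.Injective (Sum.elim f r) ∧ ∀ x ∈ F, f x = x := by
  obtain ⟨m, hm⟩ := hF.bddAbove
  -- Above `m`, the remaining names and the rigid names are kept apart by parity relative to `m`.
  refine ⟨fun x => if x ≤ m then x else m + 2 * x, fun a => m + 2 * a + 1, ?_,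
    fun x hx => if_pos (hm hx)⟩
  rintro (x | a) (y | b) e <;> simp only [Sum.elim_inl, Sum.elim_inr] at e
  · split_ifs at e <;> congr 1 <;> omega
  · split_ifs at e <;> omega
  · split_ifs at e <;> omega
  · congr 1; omega

theorem OpenBisimilar.exhibits {P Q : Proc} (hPQ : OpenBisimilar P Q) {R : Proc} (hR : R.Pure)
    {β : Action} (hβ : IsBarb β) (h : Exhibits (P.par R) β) : Exhibits (Q.par R) β := by
  obtain ⟨hP, hQ, t, -, 𝓡, H, ht⟩ := hPQ
  obtain ⟨f, r, hi, hf⟩ := exists_injective_fixing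
    (((P.fn_finite.union Q.fn_finite).union R.fn_finite).union β.fn_finite)
  -- With no restrictions and a renaming fixing all names present, the initial configuration
  -- consists of the pure processes `P | R` and `Q | R` themselves.
  have key := config_id (B := β.fn) (k := 0) (l := 0) ht (Proc.Rel.refl_of_pure hR) hi hi
    (fun b hb => ⟨hf b (.inr hb), hf b (.inr hb)⟩)
  have hself : ∀ S : Proc, S.Pure → (∀ x ∈ S.fn, f x = x) →
      Proc.resN 0 (S.app (Sub.atoms f r)) = S := by
    intro S hS hx
    refine Proc.app_eq_self (fun x h => congrArg Msg.name (hx x h)) fun a ha => ?_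
    rw [hS] at ha
    exact ha.elim
  rw [hself, hself] at key
  · exact key.exhibits H hβ h
  · exact Set.union_empty_iff.2 ⟨hQ, hR⟩
  · rintro x (hx | hx)
    · exact hf x (.inl (.inl (.inr hx)))
    · exact hf x (.inl (.inr hx))
  · exact Set.union_empty_iff.2 ⟨hP, hR⟩
  · rintro x (hx | hx)
    · exact hf x (.inl (.inl (.inl hx)))
    · exact hf x (.inl (.inr hx))

theorem OpenBisimilar.symm {P Q : Proc} (hPQ : OpenBisimilar P Q) : OpenBisimilar Q P := by
  obtain ⟨hP, hQ, h, hu, 𝓡, H, hR⟩ := hPQ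
  have hinv : h.inv = h := by
    refine (List.map_congr_left fun e he => ?_).trans (List.map_id h)
    obtain ⟨x, rfl⟩ := hu e he
    rfl
  exact ⟨hQ, hP, h, hu, 𝓡, H, hinv ▸ (H.symmetric h P Q).1 hR⟩

end Spi

theorem mainTheorem1 (P Q : Spi.Proc) (hPQ : Spi.OpenBisimilar P Q) :
    Spi.TestingEquiv P Q :=
  ⟨hPQ.1, hPQ.2.1, fun _ hR _ hβ => ⟨hPQ.exhibits hR hβ, hPQ.symm.exhibits hR hβ⟩⟩
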